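/- Let $r\ge 1$, $\sigma>0$ and $\kappa$ be given. There is a constant $C_I>0$, depending only on $r,\sigma,\kappa$, such that the following holds. Let $\Omega\subset\mathbb{R}^r$ be a bounded polyhedral domain with a conforming simplicial triangulation $\mathcal{T}_h$ which is shape regular: every $\tau\in\mathcal{T}_h$ contains a ball of radius $\operatorname{diam}(\tau)/\sigma$. Let $\rho>0$ be a measurable coefficient with $\max_\tau\rho\le\kappa\,\min_\tau\rho$ (essential maximum and minimum, the latter positive) for each $\tau\in\mathcal{T}_h$. Let $V_h$ be the space of continuous functions that are affine on each $\tau$ and zero on $\partial\Omega$, let $I^h$ be nodal interpolation into $V_h$, and $a(v,w)=\int_\Omega\rho\nabla v\cdot\nabla w\,dx$. Let $\Omega$ be partitioned into subdomains $\Omega_1,\dots,\Omega_N$, each a connected union of elements, and let $\Omega_i'\supseteq\Omega_i$ be unions of elements forming an overlapping partition such that every element lies in at most $C$ of the $\Omega_i'$. Let $V_0(\Omega_i')$ be the space of functions in $V_h$ that vanish on $\partial\Omega_i'$ and outside $\Omega_i'$. Let $\theta_1,\dots,\theta_N\ge 0$ be continuous on $\overline\Omega$ and affine on each element, with $\theta_i=0$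 outside $\Omega_i'$, and $\sum_i\theta_i=1$ at all nodes in $\Omega$ and $\sum_i\theta_i\le 1$ at all nodes on $\partial\Omega$. On the restrictions $V(\Omega_i)$ of functions in $V_h$ to $\Omega_i$ put $$a_i(v,w)=\int_{\Omega_i}\rho\nabla v\cdot\nabla w\,dx,\qquad s_i(v,w)=\int_{\Omega_i}\rho\sum_{l\in n(i)}|\nabla\theta_l|^2\,v\,w\,dx,$$ where $n(i)$ is the set of $l$ such that the support of $\theta_l$ meets $\Omega_i$. Let $\phi^{(i)}_j\in V(\Omega_i)$, with eigenvalues $\lambda^{(i)}_j$ in ascending order, be a complete $s_i$-orthonormal system of solutions of $$a_i(\phi,w)=\lambda\,s_i(\phi,w)\quad\text{for all } w\in V(\Omega_i),\qquad s_i(\phi,\phi)=1;$$ complete means that every solution of this problem is a linear combination of the $\phi^{(i)}_j$. Fix $\Lambda>0$, let $l_i$ be the number of $j$ with $\lambda_j^{(i)}<\Lambda$, and put $\pi_k\psi=\sum_{j=1}^{l_k}s_k(\psi,\phi_j^{(k)})\phi_j^{(k)}$. Let $V_{glb}$ be the span of the relaxed constrained energy-minimizing functions $$\psi_j^{(i)}=\operatorname*{argmin}_{\psi\in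 V_h}\Big\{a(\psi,\psi)+s_i(\pi_i\psi-\phi_j^{(i)},\pi_i\psi-\phi_j^{(i)})+\sum_{k\ne i}s_k(\pi_k\psi,\pi_k\psi)\Big\},\quad 1\le i\le N,\ 1\le j\le l_i.$$ Then every $u\in V_h$ can be written as $u=u_0+\sum_{i=1}^N u_i$, where $u_0\in V_{glb}$ satisfies $a(u_0,v)=a(u,v)$ for all $v\in V_{glb}$, where $u_i=I^h(\theta_i(u-u_0))\in V_0(\Omega_i')$ for $1\le i\le N$, and $$\sum_{i=1}^N a(u_i,u_i)+a(u_0,u_0)\le 2\,C\,C_I\,(1+\Lambda^{-1})\,a(u,u).$$ In particular the bound is independent of the variation of $\rho$ across elements and of the width of the overlap. -/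

import Mathlib

open scoped Gradient

noncomputable section

namespace Schwarz

/-- Euclidean space of dimension `r`. -/
abbrev Pt (r : ℕ) := EuclideanSpace ℝ (Fin r)

/-- The closed region covered by a set of simplices, each given by its vertices. -/
def region {r : ℕ} (S : Set (Finset (Pt r))) : Set (Pt r) :=
  ⋃ s ∈ S, convexHull ℝ (s : Set (Pt r))

/-- The elements (simplices of full dimension) of a simplicial complex. -/
def cells {r : ℕ} (K : Geometry.SimplicialComplex ℝ (Pt r)) : Set (Finset (Pt r)) :=
  {s | s ∈ K.faces ∧ s.card = r + 1}

/-- `v` is affine on every element. -/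
def AffineOnCells {r : ℕ} (K : Geometry.SimplicialComplex ℝ (Pt r)) (v : Pt r → ℝ) : Prop :=
  ∀ s ∈ cells K, ∃ A : Pt r →ᵃ[ℝ] ℝ, Set.EqOn v A (convexHull ℝ (s : Set (Pt r)))

/-- A bounded polyhedral domain `Ω` with a conforming triangulation `K`, a nonoverlapping partition
into subdomains, an overlapping partition, a subordinate piecewise linear partition of unity, and a
coefficient `ρ`. -/
structure Setting (r : ℕ) where
  /-- The domain. -/
  Ω : Set (Pt r)
  /-- The triangulation: a simplicial complex, so that elements meet in common faces. -/
  K : Geometry.SimplicialComplex ℝ (Pt r)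
  isOpen_Ω : IsOpen Ω
  isConnected_Ω : IsConnected Ω
  finite_faces : K.faces.Finite
  closure_Ω : closure Ω = K.space
  /-- The boundary of the domain is a union of faces of the triangulation. -/
  frontier_Ω : ∀ x ∈ frontier Ω, ∃ s ∈ K.faces,
    x ∈ convexHull ℝ (s : Set (Pt r)) ∧ convexHull ℝ (s : Set (Pt r)) ⊆ frontier Ω
  /-- The number of subdomains. -/
  N : ℕ
  /-- `sub i` is the set of elements that make up the subdomain `Ω_i`. -/
  sub : Fin N → Set (Finset (Pt r))
  sub_cells : ∀ i, sub i ⊆ cells K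
  sub_partition : ∀ s ∈ cells K, ∃! i, s ∈ sub i
  sub_connected : ∀ i, IsConnected (region (sub i))
  /-- `ext i` is the set of elements that make up the overlapping subdomain `Ω_i'`. -/
  ext : Fin N → Set (Finset (Pt r))
  ext_cells : ∀ i, ext i ⊆ cells K
  sub_ext : ∀ i, sub i ⊆ ext i
  /-- The partition of unity. -/
  θ : Fin N → Pt r → ℝ
  θ_continuousOn : ∀ i, ContinuousOn (θ i) (closure Ω)
  θ_affine : ∀ i, AffineOnCells K (θ i)
  θ_nonneg : ∀ i x, 0 ≤ θ i x
  θ_support : ∀ i, ∀ x ∉ region (ext i), θ i x = 0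
  /-- The functions sum to one at all nodes in `Ω`. At boundary nodes only `≤ 1` is asked, so that
  the functions may (but need not) vanish on the boundary of the domain. -/
  θ_sum : ∀ x ∈ K.vertices, x ∈ Ω → ∑ i, θ i x = 1
  θ_sum_le : ∀ x ∈ K.vertices, x ∈ frontier Ω → ∑ i, θ i x ≤ 1
  /-- The coefficient. -/
  ρ : Pt r → ℝ
  ρ_measurable : Measurable ρ

namespace Setting

variable {r : ℕ} (D : Setting r)

/-- Shape regularity: each element contains a ball of radius `diam / σ`. -/
def ShapeRegular (σ : ℝ) : Prop :=
  ∀ s ∈ cells D.K, ∃ c : Pt r,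
    Metric.ball c (Metric.diam (convexHull ℝ (s : Set (Pt r))) / σ) ⊆
      convexHull ℝ (s : Set (Pt r))

/-- The coefficient is positive and on each element its (essential) maximum is at most `κ` times its
(essential) minimum. Nothing is asked about its variation from one element to another. -/
def Resolves (κ : ℝ) : Prop :=
  ∀ s ∈ cells D.K, ∃ m : ℝ, 0 < m ∧
    ∀ᵐ x ∂(MeasureTheory.volume.restrict (convexHull ℝ (s : Set (Pt r)))),
      m ≤ D.ρ x ∧ D.ρ x ≤ κ * m

/-- Each element lies in at most `C` of the overlapping subdomains. -/
def OverlapAtMost (C : ℕ) : Prop :=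
  ∀ s ∈ cells D.K, Set.ncard {i | s ∈ D.ext i} ≤ C

/-- The conforming piecewise linear finite element space with zero value on the boundary; its
functions are extended by zero outside the domain. -/
def Vh : Submodule ℝ (Pt r → ℝ) where
  carrier := {v | Continuous v ∧ AffineOnCells D.K v ∧ ∀ x ∉ D.Ω, v x = 0}
  zero_mem' := ⟨continuous_const, fun _ _ => ⟨0, fun _ _ => rfl⟩, fun _ _ => rfl⟩
  add_mem' := by
    rintro v w ⟨hv, hv', hv0⟩ ⟨hw, hw', hw0⟩
    refine ⟨hv.add hw, fun s hs => ?_, fun x hx => by simp [hv0 x hx, hw0 x hx]⟩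
    obtain ⟨A, hA⟩ := hv' s hs
    obtain ⟨B, hB⟩ := hw' s hs
    exact ⟨A + B, fun x hx => by simp [hA hx, hB hx]⟩
  smul_mem' := by
    rintro c v ⟨hv, hv', hv0⟩
    refine ⟨hv.const_smul c, fun s hs => ?_, fun x hx => by simp [hv0 x hx]⟩
    obtain ⟨A, hA⟩ := hv' s hs
    exact ⟨c • A, fun x hx => by simp [hA hx]⟩

/-- `V(Ω_i)`: functions whose restriction to `Ω_i` is the restriction of a function in `V_h`. (What
such a function does outside `Ω_i` never matters.) -/
def Vsub (i : Fin D.N) : Set (Pt r → ℝ) :=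
  {v | ∃ w ∈ D.Vh, Set.EqOn v w (region (D.sub i))}

/-- `V_0(Ω_i')`: functions in `V_h` that vanish on the boundary of `Ω_i'` and outside. -/
def V0 (i : Fin D.N) : Set (Pt r → ℝ) :=
  {v | v ∈ D.Vh ∧ ∀ x ∉ interior (region (D.ext i)), v x = 0}

/-- `w` is the nodal interpolant of `v` in `V_h`. -/
def IsNodalInterpolant (v w : Pt r → ℝ) : Prop :=
  w ∈ D.Vh ∧ ∀ x ∈ D.K.vertices, w x = v x

/-- The energy form on `Ω`. -/
def a (v w : Pt r → ℝ) : ℝ := ∫ x in D.Ω, D.ρ x * inner ℝ (∇ v x) (∇ w x)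

/-- The energy form on the subdomain `Ω_i`. -/
def aSub (i : Fin D.N) (v w : Pt r → ℝ) : ℝ :=
  ∫ x in region (D.sub i), D.ρ x * inner ℝ (∇ v x) (∇ w x)

open Classical in
/-- Indices of the partition of unity functions whose support meets `Ω_i`. -/
def nbr (i : Fin D.N) : Finset (Fin D.N) :=
  Finset.univ.filter fun l => (tsupport (D.θ l) ∩ region (D.sub i)).Nonempty

/-- The weighted form `s_i` on the subdomain `Ω_i`. -/
def s (i : Fin D.N) (v w : Pt r → ℝ) : ℝ :=
  ∫ x in region (D.sub i), D.ρ x * (∑ l ∈ D.nbr i, ‖∇ (D.θ l) x‖ ^ 2) * v x * w x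

/-- `φ` solves the generalized eigenvalue problem on `Ω_i` with eigenvalue `μ`, and is normalized. -/
def IsEigenpair (i : Fin D.N) (μ : ℝ) (φ : Pt r → ℝ) : Prop :=
  φ ∈ D.Vsub i ∧ D.s i φ φ = 1 ∧ ∀ w ∈ D.Vsub i, D.aSub i φ w = μ * D.s i φ w

/-- The solutions of the generalized eigenvalue problems on all subdomains, in ascending order and
`s_i`-orthonormal. They are complete: the restriction to `Ω_i` of any normalized eigenvector is a
linear combination of the listed ones. -/
structure EigenSystem where
  num : Fin D.N → ℕ
  eig : (i : Fin D.N) → Fin (num i) → ℝ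
  φ : (i : Fin D.N) → Fin (num i) → Pt r → ℝ
  mono : ∀ i, Monotone (eig i)
  eigenpair : ∀ i j, D.IsEigenpair i (eig i j) (φ i j)
  orthogonal : ∀ i j k, j ≠ k → D.s i (φ i j) (φ i k) = 0
  complete : ∀ i μ f, D.IsEigenpair i μ f →
    ∃ c : Fin (num i) → ℝ, Set.EqOn f (∑ j, c j • φ i j) (region (D.sub i))

variable {D} (S : D.EigenSystem) (Λ : ℝ)

/-- The operator `π_k` onto the selected eigenvectors, those with eigenvalue below `Λ`. -/
def proj (k : Fin D.N) (v : Pt r → ℝ) : Pt r → ℝ :=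
  ∑ j with S.eig k j < Λ, D.s k v (S.φ k j) • S.φ k j

/-- The functional of the relaxed constrained energy minimization for the function `φ` on `Ω_i`. -/
def relaxedEnergy (i : Fin D.N) (φ ψ : Pt r → ℝ) : ℝ :=
  D.a ψ ψ + D.s i (proj S Λ i ψ - φ) (proj S Λ i ψ - φ)
    + ∑ k with k ≠ i, D.s k (proj S Λ k ψ) (proj S Λ k ψ)

/-- The global coarse space: the span of the minimizers over `V_h` of the relaxed functionals of all
selected eigenvectors. -/
def Vglb : Submodule ℝ (Pt r → ℝ) :=
  Submodule.span ℝ {ψ | ψ ∈ D.Vh ∧ ∃ i j, S.eig i j < Λ ∧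
    IsMinOn (relaxedEnergy S Λ i (S.φ i j)) D.Vh ψ}

end Setting

end Schwarz

end

/-!
The decomposition is stable because of three facts.

*Everything is a finite sum.* On an element `τ` a finite element function `v` is affine, so `a`,
`a_k` and `s_k` are sums over elements of expressions in the vertex values: `gradOn` is the constant
gradient, `energyForm` and `massForm` are the local forms, and `energy`, `aForm`, `sForm` are
bilinear forms that agree with the integrals (`a_eq_energy`, `aSub_eq_aForm`, `s_eq_sForm`). The
boundary of `Ω` and the lower-dimensional simplices are null sets. Nodal interpolants exist because
the affine pieces agree on common faces and vanish on the boundary (`exists_mem_Vh_eq_on_vertices`).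

*Local stability* (`energy_interp_mul_le`). On one element let `w` interpolate `θ * e`, with `θ`
between `0` and `1`. Subtracting the value of `θ` at one vertex from all of them bounds `‖∇w‖` by
`‖∇e‖ + (r + 1) * σ * ‖∇θ‖ * max |e|`, because barycentric coordinates have gradients of size at
most `σ / diam τ`. The maximum of `|e|` over the vertices is controlled by the mean square of `e`:
on the copy of `τ` shrunk by `1 / 4` towards the maximizing vertex, `|e|` is at least half the
maximum. As `ρ` varies by at most the factor `κ` inside an element, summation over the elements of
all `Ω_i'` gives `∑ i, a (w i) (w i) ≤ 2 * C * a e e + stabConst r σ κ * ∑ k, s_k e e`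
(`sum_energy_pieces_le`).

*Spectral bound.* Let `e = u - u₀` be the error of the energy projection onto the coarse space. The
minimizers solve `a ψ v + ∑ m, ℓ m ψ * ℓ m v = ℓ i v`, where the `ℓ m` are the coefficient
functionals of the selected eigenvectors. Hence the coarse space contains the Riesz representative
of `∑ m, ℓ m e * ℓ m`, and orthogonality of `e` to it says `∑ m, ℓ m e ^ 2 = 0`
(`functionals_eq_zero_of_orthogonal`). So `e` is `s_k`-orthogonal to all eigenvectors with
eigenvalue below `Λ`, and `Λ * s_k e e ≤ a_k e e`: otherwise the pencil restricted to the orthogonal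
complement would have an eigenvalue below `Λ` (`exists_eigenvector_of_lt`), against completeness.
Here `s_k` may be degenerate and may share a kernel with `a_k`.
-/

noncomputable section

namespace Schwarz

/-! ### Forms on finite-dimensional spaces -/

section Abstract

variable {V : Type*} [AddCommGroup V] [Module ℝ V]

/-- Riesz representation for a definite form on a finite-dimensional space. -/
theorem exists_form_eq [FiniteDimensional ℝ V] (A : V →ₗ[ℝ] V →ₗ[ℝ] ℝ)
    (hA : ∀ v, A v v = 0 → v = 0) (f : V →ₗ[ℝ] ℝ) : ∃ z, ∀ v, A z v = f v := by
  have hinj : Function.Injective A := by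
    refine (injective_iff_map_eq_zero A).2 fun v hv => hA v ?_
    simp [hv]
  have hsurj : Function.Surjective A :=
    (LinearMap.injective_iff_surjective_of_finrank_eq_finrank
      (Subspace.dual_finrank_eq (K := ℝ) (V := V)).symm).1 hinj
  obtain ⟨z, hz⟩ := hsurj f
  exact ⟨z, fun v => by rw [hz]⟩

/-- The form-orthogonal projection onto a subspace. -/
theorem exists_projection [FiniteDimensional ℝ V] (A : V →ₗ[ℝ] V →ₗ[ℝ] ℝ)
    (hA : ∀ v, A v v = 0 → v = 0) (U : Submodule ℝ V) (u : V) :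
    ∃ z ∈ U, ∀ v ∈ U, A z v = A u v := by
  obtain ⟨z, hz⟩ := exists_form_eq (A.domRestrict₁₂ U U)
    (fun v hv => Subtype.ext (hA v hv)) ((A u).domRestrict U)
  exact ⟨z, z.2, fun v hv => hz ⟨v, hv⟩⟩

/-- A positive semidefinite form vanishes on both sides of its null vectors. -/
theorem form_eq_zero_of_self_eq_zero (B : V →ₗ[ℝ] V →ₗ[ℝ] ℝ) (hsymm : ∀ v w, B v w = B w v)
    (hpos : ∀ v, 0 ≤ B v v) {f : V} (hf : B f f = 0) (w : V) : B f w = 0 := by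
  by_contra h
  have key : ∀ t : ℝ, 0 ≤ 2 * t * B f w + B w w := by
    intro t
    have := hpos (t • f + w)
    simp only [map_add, map_smul, LinearMap.add_apply, LinearMap.smul_apply, smul_eq_mul, hf,
      hsymm w f] at this
    linarith
  have := key (-(B w w + 1) / (2 * B f w))
  have h2 : 2 * (-(B w w + 1) / (2 * B f w)) * B f w = -(B w w + 1) := by
    field_simp
  linarith

/-- Let `z` be the solution of `A z v = ∑ m, ℓ m e * ℓ m v`. It is the combination, with
coefficients `ℓ m e + ℓ m z`, of the solutions of the equations for the single functionals, so that
`e` is orthogonal to it, and then `∑ m, ℓ m e ^ 2 = A z e = 0`. -/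
theorem functionals_eq_zero_of_orthogonal [FiniteDimensional ℝ V] {ι : Type*} [Fintype ι]
    (A : V →ₗ[ℝ] V →ₗ[ℝ] ℝ) (hpos : ∀ v, 0 ≤ A v v)
    (hA : ∀ v, A v v = 0 → v = 0) (l : ι → V →ₗ[ℝ] ℝ) (U : Submodule ℝ V)
    (hU : ∀ i ψ, (∀ v, A ψ v + ∑ m, l m ψ * l m v = l i v) → ψ ∈ U)
    {e : V} (he : ∀ v ∈ U, A v e = 0) (m : ι) : l m e = 0 := by
  classical
  let B : V →ₗ[ℝ] V →ₗ[ℝ] ℝ := A + ∑ m, (l m).smulRight (l m)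
  have hB : ∀ v w, B v w = A v w + ∑ m, l m v * l m w := by
    intro v w
    simp [B, LinearMap.sum_apply]
  have hB0 : ∀ v, B v v = 0 → v = 0 := by
    intro v hv
    rw [hB] at hv
    have : 0 ≤ ∑ m, l m v * l m v := Finset.sum_nonneg fun m _ => mul_self_nonneg _
    exact hA v (by linarith [hpos v])
  choose ψ hψ using fun i => exists_form_eq B hB0 (l i)
  have hψU : ∀ i, ψ i ∈ U := fun i => hU i _ fun v => by rw [← hB, hψ]
  obtain ⟨z, hz⟩ := exists_form_eq A hA (∑ m, l m e • l m)
  have hz' : ∀ v, A z v = ∑ m, l m e * l m v := by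
    intro v
    simp [hz, LinearMap.sum_apply]
  have hzU : z = ∑ m, (l m e + l m z) • ψ m := by
    rw [← sub_eq_zero]
    apply hB0
    set d := z - ∑ m, (l m e + l m z) • ψ m with hd
    have h1 : ∀ w, B d w = B z w - ∑ m, (l m e + l m z) * B (ψ m) w := by
      intro w
      simp [hd, LinearMap.sum_apply]
    rw [h1, hB, hz', ← Finset.sum_add_distrib, sub_eq_zero]
    refine Finset.sum_congr rfl fun m _ => ?_
    rw [hψ]
    ring
  have hzmem : z ∈ U := by
    rw [hzU]
    exact U.sum_mem fun m _ => U.smul_mem _ (hψU m)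
  have h0 := he z hzmem
  rw [hz'] at h0
  have := (Finset.sum_eq_zero_iff_of_nonneg fun m _ => mul_self_nonneg (l m e)).1 h0 m
    (Finset.mem_univ m)
  exact mul_self_eq_zero.1 this

/-- The solution of the variational equation minimizes the quadratic functional. -/
theorem relaxed_functional_le {ι : Type*} [Fintype ι] [DecidableEq ι]
    (A : V →ₗ[ℝ] V →ₗ[ℝ] ℝ) (hAs : ∀ v w, A v w = A w v) (hpos : ∀ v, 0 ≤ A v v)
    (l : ι → V →ₗ[ℝ] ℝ) {i : ι} {ψ : V}
    (hψ : ∀ v, A ψ v + ∑ m, l m ψ * l m v = l i v) (χ : V) :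
    A ψ ψ + ∑ m, (l m ψ - if m = i then 1 else 0) ^ 2 ≤
      A χ χ + ∑ m, (l m χ - if m = i then 1 else 0) ^ 2 := by
  have h0 := hψ (χ - ψ)
  have h1 : A χ χ = A ψ ψ + 2 * A ψ (χ - ψ) + A (χ - ψ) (χ - ψ) := by
    simp only [map_sub, LinearMap.sub_apply, hAs χ ψ]
    ring
  have h2 : ∑ m, (l m χ - if m = i then 1 else 0) ^ 2
      = ∑ m, (l m ψ - if m = i then 1 else 0) ^ 2 + 2 * ∑ m, l m ψ * l m (χ - ψ)
        - 2 * l i (χ - ψ) + ∑ m, l m (χ - ψ) ^ 2 := by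
    have h3 : l i (χ - ψ) = ∑ m, (if m = i then 1 else 0) * l m (χ - ψ) := by simp
    rw [h3, Finset.mul_sum, Finset.mul_sum, ← Finset.sum_add_distrib, ← Finset.sum_sub_distrib,
      ← Finset.sum_add_distrib]
    refine Finset.sum_congr rfl fun m _ => ?_
    rw [map_sub]
    ring
  have h4 : 0 ≤ ∑ m, l m (χ - ψ) ^ 2 := Finset.sum_nonneg fun m _ => sq_nonneg _
  have h5 := hpos (χ - ψ)
  rw [h1, h2]
  linarith

/-- For two positive semidefinite forms, the largest eigenvalue of `B` relative to `A + B`. The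
forms may have a common kernel; the maximum is taken on a complement of it. -/
theorem exists_maximizer [FiniteDimensional ℝ V] (A B : V →ₗ[ℝ] V →ₗ[ℝ] ℝ)
    (hAs : ∀ v w, A v w = A w v) (hBs : ∀ v w, B v w = B w v)
    (hA : ∀ v, 0 ≤ A v v) (hB : ∀ v, 0 ≤ B v v) {v₀ : V} (hv₀ : 0 < B v₀ v₀) :
    ∃ f, A f f + B f f = 1 ∧ ∀ v, B v v ≤ B f f * (A v v + B v v) := by
  let G := A + B
  have hG : ∀ v w, G v w = A v w + B v w := fun _ _ => rfl
  have hGs : ∀ v w, G v w = G w v := fun v w => by rw [hG, hG, hAs, hBs]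
  have hGp : ∀ v, 0 ≤ G v v := fun v => add_nonneg (hA v) (hB v)
  obtain ⟨M, hM⟩ := Submodule.exists_isCompl (LinearMap.ker G)
  -- vectors in the kernel of `G` do not contribute to `B`
  have hker : ∀ k ∈ LinearMap.ker G, ∀ v, B k v = 0 ∧ A k v = 0 := by
    intro k hk v
    have h0 : G k k = 0 := by rw [LinearMap.mem_ker.1 hk]; rfl
    rw [hG] at h0
    exact ⟨form_eq_zero_of_self_eq_zero B hBs hB (by linarith [hA k, hB k]) v,
      form_eq_zero_of_self_eq_zero A hAs hA (by linarith [hA k, hB k]) v⟩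
  have hdec : ∀ v, ∃ m : M, B v v = B m m ∧ A v v = A m m := by
    intro v
    obtain ⟨k, hk, m, hm, rfl⟩ := Submodule.mem_sup.1
      (show v ∈ LinearMap.ker G ⊔ M by rw [hM.sup_eq_top]; trivial)
    refine ⟨⟨m, hm⟩, ?_, ?_⟩
    · simp only [map_add, LinearMap.add_apply, hBs m k]
      simp [(hker k hk _).1]
    · simp only [map_add, LinearMap.add_apply, hAs m k]
      simp [(hker k hk _).2]
  let core : InnerProductSpace.Core ℝ M :=
    { inner := fun v w => G v w
      conj_inner_symm := fun v w => by simp [hGs]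
      re_inner_nonneg := fun v => hGp v
      add_left := fun x y z => by simp
      smul_left := fun x y c => by simp
      definite := fun v hv => by
        have h1 : (v : V) ∈ LinearMap.ker G :=
          LinearMap.mem_ker.2 (LinearMap.ext fun w => form_eq_zero_of_self_eq_zero G hGs hGp hv w)
        have := Submodule.disjoint_def.1 hM.disjoint v h1 v.2
        exact Subtype.ext this }
  let : NormedAddCommGroup M := core.toNormedAddCommGroup
  let : InnerProductSpace ℝ M := InnerProductSpace.ofCore core.toCore
  have hnorm : ∀ v : M, ‖v‖ ^ 2 = A v v + B v v := fun v =>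
    (real_inner_self_eq_norm_sq v).symm
  have : ProperSpace M := FiniteDimensional.proper ℝ M
  obtain ⟨m₀, hm₀, -⟩ := hdec v₀
  have hm₀ne : m₀ ≠ 0 := by
    rintro rfl
    simp at hm₀
    linarith
  have hcont : Continuous fun v : M => B v v := by
    let b : M →ₗ[ℝ] M →L[ℝ] ℝ :=
      LinearMap.toContinuousLinearMap.toLinearMap ∘ₗ (B.domRestrict₁₂ M M)
    have hb : Continuous fun v : M => (LinearMap.toContinuousLinearMap b v) v := by fun_prop
    exact hb
  obtain ⟨f, hf, hmax⟩ := (isCompact_sphere (0 : M) 1).exists_isMaxOn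
    ⟨‖m₀‖⁻¹ • m₀, by simp [norm_smul, hm₀ne]⟩ hcont.continuousOn
  have hf1 : ‖f‖ = 1 := by simpa using hf
  refine ⟨f, by rw [← hnorm, hf1, one_pow], fun v => ?_⟩
  obtain ⟨m, h1, h2⟩ := hdec v
  rw [h1, h2, ← hnorm]
  by_cases hm : m = 0
  · simp [hm]
  have h3 := hmax (show ‖m‖⁻¹ • m ∈ Metric.sphere (0 : M) 1 by simp [norm_smul, hm])
  simp only [Set.mem_ofPred_eq, Submodule.coe_smul, map_smul, LinearMap.smul_apply,
    smul_eq_mul] at h3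
  have hpos : 0 < ‖m‖ := norm_pos_iff.2 hm
  have h4 : B m m = ‖m‖ ^ 2 * (‖m‖⁻¹ * (‖m‖⁻¹ * B m m)) := by field_simp
  rw [h4, mul_comm]
  exact mul_le_mul_of_nonneg_right h3 (by positivity)

/-- If `A` is not bounded below by `Λ * B`, then the pencil has an eigenvalue below `Λ`. -/
theorem exists_eigenvector_of_lt [FiniteDimensional ℝ V] (A B : V →ₗ[ℝ] V →ₗ[ℝ] ℝ)
    (hAs : ∀ v w, A v w = A w v) (hBs : ∀ v w, B v w = B w v)
    (hA : ∀ v, 0 ≤ A v v) (hB : ∀ v, 0 ≤ B v v) {Λ : ℝ} {v₀ : V}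
    (hv₀ : A v₀ v₀ < Λ * B v₀ v₀) :
    ∃ f μ, μ < Λ ∧ B f f = 1 ∧ ∀ w, A f w = μ * B f w := by
  have hv₀' : 0 < B v₀ v₀ := by
    by_contra h
    have : B v₀ v₀ = 0 := le_antisymm (not_lt.1 h) (hB _)
    rw [this] at hv₀
    linarith [hA v₀]
  obtain ⟨f, hf1, hf⟩ := exists_maximizer A B hAs hBs hA hB hv₀'
  set b := B f f with hb
  have hbpos : 0 < b := by
    have := hf v₀
    by_contra h
    nlinarith [hA v₀]
  -- the form `b * A - (1 - b) * B` is positive semidefinite and vanishes at `f`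
  have hker := form_eq_zero_of_self_eq_zero (b • A - (1 - b) • B)
    (fun v w => by simp [hAs v w, hBs v w])
    (fun v => by
      have := hf v
      simp only [LinearMap.sub_apply, LinearMap.smul_apply, smul_eq_mul]
      linarith) (f := f) (by
      simp only [LinearMap.sub_apply, LinearMap.smul_apply, smul_eq_mul, ← hb]
      have : A f f = 1 - b := by linarith
      rw [this]; ring)
  refine ⟨(√b)⁻¹ • f, (1 - b) / b, ?_, ?_, fun w => ?_⟩
  · rw [div_lt_iff₀ hbpos]
    have := hf v₀
    -- `B v₀ v₀ ≤ b * (A v₀ v₀ + B v₀ v₀) < b * (Λ + 1) * B v₀ v₀`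
    have h2 : b * (A v₀ v₀ + B v₀ v₀) < b * (Λ + 1) * B v₀ v₀ := by nlinarith
    have h3 : 1 < b * (Λ + 1) := by
      by_contra h
      nlinarith
    linarith
  · simp only [map_smul, LinearMap.smul_apply, smul_eq_mul, ← hb]
    have := Real.sq_sqrt hbpos.le
    have h2 := (Real.sqrt_pos.2 hbpos).ne'
    field_simp
    linarith
  · have h := hker w
    simp only [LinearMap.sub_apply, LinearMap.smul_apply, smul_eq_mul] at h
    simp only [map_smul, LinearMap.smul_apply, smul_eq_mul]
    have : A f w = (1 - b) / b * B f w := by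
      field_simp
      linarith
    rw [this]; ring

/-- Spectral estimate off a set of known eigenvectors. Let the `φ j` be `B`-orthonormal eigenvectors
such that every normalized eigenvector `f` with eigenvalue below `Λ` has some `B f (φ j) ≠ 0`.
Then `Λ * B e e ≤ A e e` for `e` orthogonal to all `φ j`. -/
theorem mul_form_le_of_orthogonal [FiniteDimensional ℝ V] {ι : Type*} [Fintype ι]
    (A B : V →ₗ[ℝ] V →ₗ[ℝ] ℝ)
    (hAs : ∀ v w, A v w = A w v) (hBs : ∀ v w, B v w = B w v)
    (hA : ∀ v, 0 ≤ A v v) (hB : ∀ v, 0 ≤ B v v) {Λ : ℝ}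
    (φ : ι → V) (eig : ι → ℝ) (hφ : ∀ i j, i ≠ j → B (φ i) (φ j) = 0)
    (hφ1 : ∀ i, B (φ i) (φ i) = 1) (heig : ∀ i w, A (φ i) w = eig i * B (φ i) w)
    (hcompl : ∀ f μ, μ < Λ → B f f = 1 → (∀ w, A f w = μ * B f w) → ∃ j, B f (φ j) ≠ 0)
    {e : V} (he : ∀ j, B e (φ j) = 0) : Λ * B e e ≤ A e e := by
  by_contra! hlt
  let X : Submodule ℝ V := ⨅ j, LinearMap.ker (B (φ j))
  have hX : ∀ v, v ∈ X ↔ ∀ j, B v (φ j) = 0 := by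
    intro v
    simp [X, Submodule.mem_iInf, hBs v]
  obtain ⟨f, μ, hμ, hf1, hf⟩ := exists_eigenvector_of_lt (A.domRestrict₁₂ X X)
    (B.domRestrict₁₂ X X) (fun v w => hAs v w) (fun v w => hBs v w) (fun v => hA v)
    (fun v => hB v) (v₀ := ⟨e, (hX e).2 he⟩) hlt
  have hfX := (hX f).1 f.2
  obtain ⟨j, hj⟩ := hcompl f μ hμ hf1 (by
    intro w
    -- the component of `w` in the span of the `φ j` is orthogonal to `f` for both forms
    have hw : w - ∑ j, B w (φ j) • φ j ∈ X := by
      rw [hX]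
      intro k
      rw [map_sub, LinearMap.sub_apply, map_sum, LinearMap.sum_apply, Finset.sum_eq_single k]
      · simp [hφ1]
      · intro i _ hik
        simp [hφ i k hik]
      · simp
    have h := hf ⟨_, hw⟩
    have hAφ : ∀ j, A f (φ j) = 0 := fun j => by rw [hAs, heig, hBs, hfX, mul_zero]
    simpa [LinearMap.domRestrict₁₂_apply, map_sub, map_sum, hAφ, hfX] using h)
  exact hj (hfX j)

end Abstract

/-! ### Affine functions on one simplex -/

section Simplex

open MeasureTheory Set

variable {r : ℕ}

/-- The constant gradient of an affine function. -/
def affineGrad : (Pt r →ᵃ[ℝ] ℝ) →ₗ[ℝ] Pt r where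
  toFun A := (InnerProductSpace.toDual ℝ (Pt r)).symm (LinearMap.toContinuousLinearMap A.linear)
  map_add' A B := by simp
  map_smul' c A := by simp

theorem inner_affineGrad (A : Pt r →ᵃ[ℝ] ℝ) (y : Pt r) :
    inner ℝ (affineGrad A) y = A.linear y := by
  simp [affineGrad, InnerProductSpace.toDual_symm_apply]

theorem affine_sub_eq_inner (A : Pt r →ᵃ[ℝ] ℝ) (x y : Pt r) :
    A x - A y = inner ℝ (affineGrad A) (x - y) := by
  rw [inner_affineGrad, ← vsub_eq_sub x y, A.linearMap_vsub, vsub_eq_sub]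

theorem continuous_affine (A : Pt r →ᵃ[ℝ] ℝ) : Continuous A := A.continuous_of_finiteDimensional

theorem hasGradientAt_affine (A : Pt r →ᵃ[ℝ] ℝ) (x : Pt r) :
    HasGradientAt A (affineGrad A) x := by
  rw [hasGradientAt_iff_isLittleO]
  have : (fun x' => A x' - A x - inner ℝ (affineGrad A) (x' - x)) = fun _ => 0 := by
    ext x'
    rw [affine_sub_eq_inner, sub_self]
  rw [this]
  exact Asymptotics.isLittleO_zero _ _

theorem abs_affine_sub_le (A : Pt r →ᵃ[ℝ] ℝ) (x y : Pt r) :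
    |A x - A y| ≤ ‖affineGrad A‖ * dist x y := by
  rw [affine_sub_eq_inner, dist_eq_norm]
  exact abs_real_inner_le_norm _ _

variable {ι : Type*} (b : AffineBasis ι ℝ (Pt r))

/-- The closed simplex spanned by an affine basis. -/
def hull : Set (Pt r) := convexHull ℝ (range b)

theorem vertex_mem_hull (i : ι) : b i ∈ hull b := subset_convexHull ℝ _ (mem_range_self i)

theorem coord_nonneg {x : Pt r} (hx : x ∈ hull b) (i : ι) : 0 ≤ b.coord i x := by
  rw [hull, b.convexHull_eq_nonneg_coord] at hx
  exact hx i

theorem interior_hull_ae : (interior (hull b) : Set (Pt r)) =ᵐ[volume] hull b :=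
  interior_ae_eq_of_null_frontier ((convex_convexHull ℝ _).addHaar_frontier _)

theorem setIntegral_hull_congr {f g : Pt r → ℝ} (h : ∀ x ∈ interior (hull b), f x = g x) :
    ∫ x in hull b, f x = ∫ x in hull b, g x := by
  rw [← setIntegral_congr_set (interior_hull_ae b), ← setIntegral_congr_set (interior_hull_ae b)]
  exact setIntegral_congr_fun isOpen_interior.measurableSet h

theorem integrableOn_hull_congr {f g : Pt r → ℝ} (h : ∀ x ∈ interior (hull b), f x = g x)
    (hg : IntegrableOn g (hull b)) : IntegrableOn f (hull b) := by
  rw [← integrableOn_congr_set_ae (interior_hull_ae b)] at hg ⊢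
  exact hg.congr_fun (fun x hx => (h x hx).symm) isOpen_interior.measurableSet

variable [Fintype ι]

/-- The affine function with the same values at the vertices. -/
def interp : (Pt r → ℝ) →ₗ[ℝ] (Pt r →ᵃ[ℝ] ℝ) where
  toFun v := ∑ i, v (b i) • b.coord i
  map_add' v w := by simp [add_smul, Finset.sum_add_distrib]
  map_smul' c v := by simp [Finset.smul_sum, smul_smul]

/-- The gradient of the affine function with the same values at the vertices. -/
def gradOn : (Pt r → ℝ) →ₗ[ℝ] Pt r := affineGrad ∘ₗ interp b

theorem interp_apply (v : Pt r → ℝ) (x : Pt r) : interp b v x = ∑ i, v (b i) * b.coord i x := by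
  have : ∀ s : Finset ι, (∑ i ∈ s, v (b i) • b.coord i : Pt r →ᵃ[ℝ] ℝ) x
      = ∑ i ∈ s, v (b i) * b.coord i x := by
    classical
    intro s
    induction s using Finset.induction_on with
    | empty => simp
    | insert i s hi ih => simp [Finset.sum_insert hi, ih]
  exact this _

theorem interp_vertex (v : Pt r → ℝ) (i : ι) : interp b v (b i) = v (b i) := by
  classical
  simp [interp_apply, AffineBasis.coord_apply]

theorem interp_eq {v : Pt r → ℝ} {A : Pt r →ᵃ[ℝ] ℝ} (h : ∀ i, v (b i) = A (b i)) :
    interp b v = A := by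
  refine AffineMap.ext_on b.tot ?_
  rintro _ ⟨i, rfl⟩
  rw [interp_vertex, h]

theorem gradOn_eq_sum (v : Pt r → ℝ) :
    gradOn b v = ∑ i, v (b i) • affineGrad (b.coord i) := by
  simp [gradOn, interp]

theorem isCompact_hull : IsCompact (hull b) := (finite_range b).isCompact_convexHull ℝ

theorem measurableSet_hull : MeasurableSet (hull b) := (isCompact_hull b).measurableSet

theorem coord_le_one {x : Pt r} (hx : x ∈ hull b) (i : ι) : b.coord i x ≤ 1 := by
  rw [← b.sum_coord_apply_eq_one x]
  exact Finset.single_le_sum (fun j _ => coord_nonneg b hx j) (Finset.mem_univ i)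

theorem nonempty_interior_hull : (interior (hull b)).Nonempty :=
  ⟨_, b.centroid_mem_interior_convexHull⟩

theorem volume_hull_pos : 0 < volume.real (hull b) := by
  refine ENNReal.toReal_pos ?_ (isCompact_hull b).measure_lt_top.ne
  exact (Measure.measure_pos_of_nonempty_interior _ (nonempty_interior_hull b)).ne'

theorem gradient_eq_gradOn {v : Pt r → ℝ} (hv : EqOn v (interp b v) (hull b)) {x : Pt r}
    (hx : x ∈ interior (hull b)) : ∇ v x = gradOn b v := by
  refine HasGradientAt.gradient ?_
  refine (hasGradientAt_affine (interp b v) x).congr_of_eventuallyEq ?_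
  exact Filter.eventuallyEq_of_mem (mem_interior_iff_mem_nhds.1 hx) hv

theorem abs_interp_le {v : Pt r → ℝ} {M : ℝ} (hM : ∀ i, |v (b i)| ≤ M) {x : Pt r}
    (hx : x ∈ hull b) : |interp b v x| ≤ M := by
  rw [interp_apply]
  calc |∑ i, v (b i) * b.coord i x| ≤ ∑ i, |v (b i) * b.coord i x| := Finset.abs_sum_le_sum_abs _ _
    _ ≤ ∑ i, M * b.coord i x := by
        refine Finset.sum_le_sum fun i _ => ?_
        rw [abs_mul, abs_of_nonneg (coord_nonneg b hx i)]
        exact mul_le_mul_of_nonneg_right (hM i) (coord_nonneg b hx i)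
    _ = M := by rw [← Finset.mul_sum, b.sum_coord_apply_eq_one, mul_one]

/-- A barycentric coordinate varies by at most one along a radius of an inscribed ball. -/
theorem norm_affineGrad_coord_le {c : Pt r} {d : ℝ} (hd : 0 < d)
    (hball : Metric.ball c d ⊆ hull b) (i : ι) : ‖affineGrad (b.coord i)‖ * d ≤ 1 := by
  set g := affineGrad (b.coord i) with hg
  by_cases h0 : g = 0
  · simp [h0]
  have hpos : 0 < ‖g‖ := norm_pos_iff.2 h0
  have hcl : Metric.closedBall c d ⊆ hull b := by
    rw [← closure_ball c hd.ne']
    exact closure_minimal hball (isCompact_hull b).isClosed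
  have hx : c + (d / ‖g‖) • g ∈ hull b := hcl (by
    rw [mem_closedBall_iff_norm, add_sub_cancel_left, norm_smul, Real.norm_of_nonneg (by positivity),
      div_mul_cancel₀ _ hpos.ne'])
  have hc : c ∈ hull b := hcl (Metric.mem_closedBall_self hd.le)
  have h1 := affine_sub_eq_inner (b.coord i) (c + (d / ‖g‖) • g) c
  rw [add_sub_cancel_left, ← hg, real_inner_smul_right, real_inner_self_eq_norm_sq] at h1
  have h2 := coord_nonneg b hc i
  have h3 := coord_le_one b hx i
  have h4 : d / ‖g‖ * ‖g‖ ^ 2 = ‖g‖ * d := by field_simp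
  linarith

/-- An affine function is at least half its largest vertex value on the copy of the simplex
scaled by `1 / 4` towards the vertex where that value is attained. -/
theorem sq_vertex_mul_volume_le {ρ : Pt r → ℝ} {m : ℝ} (hm : 0 < m)
    (hρ : IntegrableOn ρ (hull b)) (hmρ : ∀ᵐ x ∂(volume.restrict (hull b)), m ≤ ρ x)
    (v : Pt r → ℝ) (i : ι) :
    m * volume.real (hull b) * v (b i) ^ 2 ≤
      4 ^ (r + 1) * ∫ x in hull b, ρ x * (interp b v x * interp b v x) := by
  have := b.nonempty
  obtain ⟨j, hj⟩ := Finite.exists_max fun i => |v (b i)|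
  set M := |v (b j)| with hM
  have hM0 : 0 ≤ M := abs_nonneg _
  set A := interp b v with hA
  have hAc : Continuous A := continuous_affine A
  let T' : Set (Pt r) := AffineMap.homothety (b j) (1 / 4 : ℝ) '' hull b
  have hT' : T' ⊆ hull b := by
    rintro _ ⟨y, hy, rfl⟩
    rw [AffineMap.homothety_eq_lineMap]
    exact (convex_convexHull ℝ _).lineMap_mem (vertex_mem_hull b j) hy ⟨by norm_num, by norm_num⟩
  have hT'c : IsCompact T' := (isCompact_hull b).image
    (AffineMap.continuous_of_finiteDimensional _)
  have hlow : ∀ x ∈ T', M ^ 2 / 4 ≤ A x * A x := by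
    rintro _ ⟨y, hy, rfl⟩
    have h1 : |A y| ≤ M := abs_interp_le b hj hy
    have h2 : A (AffineMap.homothety (b j) (1 / 4 : ℝ) y) = v (b j) + (1 / 4) * (A y - v (b j)) := by
      rw [AffineMap.homothety_eq_lineMap, AffineMap.apply_lineMap, AffineMap.lineMap_apply_ring',
        hA, interp_vertex]
      ring
    rw [h2]
    have h3 : M ^ 2 = v (b j) ^ 2 := sq_abs _
    rw [abs_le] at h1
    rcases abs_cases (v (b j)) with ⟨h, h'⟩ | ⟨h, h'⟩ <;> rw [← hM] at h <;> nlinarith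
  have hvol : volume.real T' = (1 / 4) ^ r * volume.real (hull b) := by
    rw [Measure.real, Measure.addHaar_image_homothety, ENNReal.toReal_mul, ENNReal.toReal_ofReal
      (abs_nonneg _), finrank_euclideanSpace_fin, abs_of_nonneg (by positivity), Measure.real]
  have hint : IntegrableOn (fun x => ρ x * (A x * A x)) (hull b) :=
    hρ.mul_continuousOn (hAc.mul hAc).continuousOn (isCompact_hull b)
  have hnn : 0 ≤ᵐ[volume.restrict (hull b)] fun x => ρ x * (A x * A x) := by
    filter_upwards [hmρ] with x hx
    exact mul_nonneg (hm.le.trans hx) (mul_self_nonneg _)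
  have h1 : m * (M ^ 2 / 4) * volume.real T' ≤ ∫ x in hull b, ρ x * (A x * A x) := by
    calc m * (M ^ 2 / 4) * volume.real T' = ∫ _x in T', m * (M ^ 2 / 4) := by
          rw [setIntegral_const, smul_eq_mul, mul_comm]
      _ ≤ ∫ x in T', ρ x * (A x * A x) := by
          refine setIntegral_mono_on_ae (integrableOn_const hT'c.measure_lt_top.ne)
            (hint.mono_set hT') hT'c.measurableSet ?_
          filter_upwards [(ae_restrict_iff' (measurableSet_hull b)).1 hmρ] with x hx hxT
          exact mul_le_mul (hx (hT' hxT)) (hlow x hxT) (by positivity) (hm.le.trans (hx (hT' hxT)))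
      _ ≤ _ := setIntegral_mono_set hint hnn (Filter.Eventually.of_forall hT')
  rw [hvol] at h1
  have h2 : v (b i) ^ 2 ≤ M ^ 2 := sq_le_sq' (by linarith [neg_abs_le (v (b i)), hj i])
    ((le_abs_self _).trans (hj i))
  have hV := (volume_hull_pos b).le
  calc m * volume.real (hull b) * v (b i) ^ 2 ≤ m * volume.real (hull b) * M ^ 2 := by gcongr
    _ = 4 ^ (r + 1) * (m * (M ^ 2 / 4) * ((1 / 4) ^ r * volume.real (hull b))) := by
        rw [div_pow, one_pow]
        field_simp
        ring
    _ ≤ _ := by gcongr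

/-- The gradient of the nodal interpolant of `θ * e`: after subtracting the value of `θ` at one
vertex, the vertex values of `θ` are bounded by its gradient times the diameter. -/
theorem norm_gradOn_mul_le {σ : ℝ} (hσ : 0 < σ) {c : Pt r}
    (hball : Metric.ball c (Metric.diam (hull b) / σ) ⊆ hull b)
    (hd : 0 < Metric.diam (hull b)) {θ e w : Pt r → ℝ}
    (hθ0 : ∀ i, 0 ≤ θ (b i)) (hθ1 : ∀ i, θ (b i) ≤ 1) (hw : ∀ i, w (b i) = θ (b i) * e (b i))
    {M : ℝ} (hM : ∀ i, |e (b i)| ≤ M) :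
    ‖gradOn b w‖ ≤ ‖gradOn b e‖ + (r + 1) * σ * (‖gradOn b θ‖ * M) := by
  obtain ⟨j⟩ := b.nonempty
  set d := Metric.diam (hull b) with hd'
  have hM0 : 0 ≤ M := (abs_nonneg _).trans (hM j)
  have h1 : gradOn b w = θ (b j) • gradOn b e
      + ∑ i, ((θ (b i) - θ (b j)) * e (b i)) • affineGrad (b.coord i) := by
    rw [gradOn_eq_sum, gradOn_eq_sum, Finset.smul_sum, ← Finset.sum_add_distrib]
    refine Finset.sum_congr rfl fun i _ => ?_
    rw [smul_smul, ← add_smul, hw]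
    congr 1
    ring
  have h2 : ∀ i, |θ (b i) - θ (b j)| ≤ ‖gradOn b θ‖ * d := by
    intro i
    rw [← interp_vertex b θ i, ← interp_vertex b θ j]
    refine (abs_affine_sub_le _ _ _).trans ?_
    exact mul_le_mul_of_nonneg_left (Metric.dist_le_diam_of_mem (isCompact_hull b).isBounded
      (vertex_mem_hull b i) (vertex_mem_hull b j)) (norm_nonneg _)
  have h3 : ∀ i, ‖((θ (b i) - θ (b j)) * e (b i)) • affineGrad (b.coord i)‖
      ≤ σ * (‖gradOn b θ‖ * M) := by
    intro i
    have hc := norm_affineGrad_coord_le b (div_pos hd hσ) hball i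
    have hc' : d * ‖affineGrad (b.coord i)‖ ≤ σ := by
      have : ‖affineGrad (b.coord i)‖ * (d / σ) = d * ‖affineGrad (b.coord i)‖ / σ := by ring
      rw [this, div_le_one hσ] at hc
      exact hc
    rw [norm_smul, Real.norm_eq_abs, abs_mul]
    calc |θ (b i) - θ (b j)| * |e (b i)| * ‖affineGrad (b.coord i)‖
        ≤ (‖gradOn b θ‖ * d) * M * ‖affineGrad (b.coord i)‖ := by
          gcongr
          · exact h2 i
          · exact hM i
      _ = (d * ‖affineGrad (b.coord i)‖) * (‖gradOn b θ‖ * M) := by ring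
      _ ≤ _ := by gcongr
  have hcard : (Fintype.card ι : ℝ) = r + 1 := by
    rw [b.card_eq_finrank_add_one, finrank_euclideanSpace_fin]
    push_cast
    ring
  rw [h1]
  refine (norm_add_le _ _).trans (add_le_add ?_ ((norm_sum_le _ _).trans
    ((Finset.sum_le_sum fun i _ => h3 i).trans ?_)))
  · rw [norm_smul, Real.norm_of_nonneg (hθ0 j)]
    exact mul_le_of_le_one_left (norm_nonneg _) (hθ1 j)
  · rw [Finset.sum_const, Finset.card_univ, nsmul_eq_mul, hcard, mul_assoc]

/-- Stability on one element of multiplication by `θ` followed by nodal interpolation. -/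
theorem energy_interp_mul_le {σ κ m : ℝ} (hσ : 0 < σ) (hm : 0 < m) {c : Pt r}
    (hball : Metric.ball c (Metric.diam (hull b) / σ) ⊆ hull b)
    (hd : 0 < Metric.diam (hull b)) {ρ : Pt r → ℝ} (hρ : IntegrableOn ρ (hull b))
    (hmρ : ∀ᵐ x ∂(volume.restrict (hull b)), m ≤ ρ x ∧ ρ x ≤ κ * m)
    {θ e w : Pt r → ℝ} (hθ0 : ∀ i, 0 ≤ θ (b i)) (hθ1 : ∀ i, θ (b i) ≤ 1)
    (hw : ∀ i, w (b i) = θ (b i) * e (b i)) :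
    (∫ x in hull b, ρ x) * ‖gradOn b w‖ ^ 2 ≤
      2 * ((∫ x in hull b, ρ x) * ‖gradOn b e‖ ^ 2) +
      2 * ((r + 1) * σ) ^ 2 * κ * 4 ^ (r + 1) *
        (‖gradOn b θ‖ ^ 2 * ∫ x in hull b, ρ x * (interp b e x * interp b e x)) := by
  have := b.nonempty
  obtain ⟨j, hj⟩ := Finite.exists_max fun i => |e (b i)|
  set R := ∫ x in hull b, ρ x
  set I := ∫ x in hull b, ρ x * (interp b e x * interp b e x)
  set V := volume.real (hull b)
  have hV : 0 < V := volume_hull_pos b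
  have hmass : m * V * e (b j) ^ 2 ≤ 4 ^ (r + 1) * I :=
    sq_vertex_mul_volume_le b hm hρ (hmρ.mono fun x hx => hx.1) e j
  have hRup : R ≤ κ * m * V := by
    calc R ≤ ∫ _x in hull b, κ * m := by
          refine setIntegral_mono_on_ae hρ
            (integrableOn_const (isCompact_hull b).measure_lt_top.ne) (measurableSet_hull b) ?_
          filter_upwards [(ae_restrict_iff' (measurableSet_hull b)).1 hmρ] with x hx hxT
          exact (hx hxT).2
      _ = κ * m * V := by rw [setIntegral_const, smul_eq_mul, mul_comm]
  have hR0 : 0 ≤ R := by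
    refine setIntegral_nonneg_of_ae_restrict ?_
    filter_upwards [hmρ] with x hx
    exact hm.le.trans hx.1
  have hκ : 0 ≤ κ := by
    by_contra h
    have : κ * m * V < 0 := mul_neg_of_neg_of_pos (mul_neg_of_neg_of_pos (not_le.1 h) hm) hV
    linarith
  have hgrad := norm_gradOn_mul_le b hσ hball hd hθ0 hθ1 hw hj
  set G := ‖gradOn b θ‖
  set s := (r + 1) * σ
  have h1 : ‖gradOn b w‖ ^ 2 ≤ 2 * ‖gradOn b e‖ ^ 2 + 2 * s ^ 2 * (G ^ 2 * e (b j) ^ 2) := by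
    calc ‖gradOn b w‖ ^ 2 ≤ (‖gradOn b e‖ + s * (G * |e (b j)|)) ^ 2 := by gcongr
      _ ≤ 2 * (‖gradOn b e‖ ^ 2 + (s * (G * |e (b j)|)) ^ 2) := add_sq_le
      _ = _ := by rw [mul_pow s, mul_pow G, sq_abs]; ring
  calc R * ‖gradOn b w‖ ^ 2
      ≤ R * (2 * ‖gradOn b e‖ ^ 2 + 2 * s ^ 2 * (G ^ 2 * e (b j) ^ 2)) := by gcongr
    _ = 2 * (R * ‖gradOn b e‖ ^ 2) + 2 * s ^ 2 * G ^ 2 * (R * e (b j) ^ 2) := by ring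
    _ ≤ 2 * (R * ‖gradOn b e‖ ^ 2) + 2 * s ^ 2 * G ^ 2 * (κ * (4 ^ (r + 1) * I)) := by
        have : R * e (b j) ^ 2 ≤ κ * (4 ^ (r + 1) * I) := by
          calc R * e (b j) ^ 2 ≤ κ * m * V * e (b j) ^ 2 := by gcongr
            _ = κ * (m * V * e (b j) ^ 2) := by ring
            _ ≤ _ := by gcongr
        gcongr
    _ = _ := by ring

end Simplex

/-! ### The triangulation -/

open MeasureTheory Set

theorem eqOn_convexHull_of_eqOn {r : ℕ} {A B : Pt r →ᵃ[ℝ] ℝ} {s : Set (Pt r)} (h : EqOn A B s) :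
    EqOn A B (convexHull ℝ s) :=
  (AffineMap.eqOn_affineSpan h).mono (convexHull_subset_affineSpan s)

theorem volume_convexHull_eq_zero {r : ℕ} {s : Finset (Pt r)} (hs : s.card ≤ r) :
    volume (convexHull ℝ (s : Set (Pt r))) = 0 := by
  refine measure_mono_null (convexHull_subset_affineSpan _)
    (Measure.addHaar_affineSubspace _ _ fun htop => ?_)
  rcases s.eq_empty_or_nonempty with rfl | hne
  · simp at htop
  have : Nonempty s := hne.to_subtype
  have h1 := finrank_vectorSpan_range_add_one_le ℝ ((↑) : s → Pt r)
  have h2 : vectorSpan ℝ (range ((↑) : s → Pt r)) = ⊤ := by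
    rw [Subtype.range_coe, ← direction_affineSpan]
    erw [htop]
    exact AffineSubspace.direction_top _ _ _
  rw [h2, finrank_top, finrank_euclideanSpace_fin, Fintype.card_coe] at h1
  omega

namespace Setting

variable {r : ℕ} (D : Setting r)

/-- The elements of the triangulation, as a type. -/
abbrev Cell := {s : Finset (Pt r) // s ∈ cells D.K}

instance : Finite D.Cell := (D.finite_faces.subset fun _ hs => hs.1).to_subtype

instance : Fintype D.Cell := Fintype.ofFinite _

variable {D}

/-- The vertices of an element, as an affine basis of the ambient space. -/
def Cell.basis (τ : D.Cell) : AffineBasis τ.1 ℝ (Pt r) where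
  toFun := (↑)
  ind' := D.K.indep τ.2.1
  tot' := (D.K.indep τ.2.1).affineSpan_eq_top_iff_card_eq_finrank_add_one.2 (by
    rw [Fintype.card_coe, finrank_euclideanSpace_fin, τ.2.2])

theorem Cell.basis_apply (τ : D.Cell) (x : τ.1) : τ.basis x = x := rfl

theorem Cell.hull_eq (τ : D.Cell) : hull τ.basis = convexHull ℝ (τ.1 : Set (Pt r)) := by
  rw [hull]
  congr 1
  exact Subtype.range_coe

theorem card_le_of_mem_faces {s : Finset (Pt r)} (hs : s ∈ D.K.faces) : s.card ≤ r + 1 := by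
  have h1 := (D.K.indep hs).card_le_finrank_succ
  have h2 := Submodule.finrank_le (vectorSpan ℝ (range ((↑) : s → Pt r)))
  rw [finrank_euclideanSpace_fin] at h2
  rw [Fintype.card_coe] at h1
  omega

variable (D)

theorem volume_lower_faces :
    volume (⋃ s ∈ {s ∈ D.K.faces | s.card ≤ r}, convexHull ℝ (s : Set (Pt r))) = 0 :=
  (measure_biUnion_null_iff (D.finite_faces.subset fun _ hs => hs.1).countable).2
    fun _ hs => volume_convexHull_eq_zero hs.2

theorem isClosed_iUnion_hull : IsClosed (⋃ τ : D.Cell, hull τ.basis) :=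
  isClosed_iUnion_of_finite fun τ => (isCompact_hull τ.basis).isClosed

/-- The closed domain is covered by the simplices of full dimension: the others are null sets, so
they cannot cover an open piece of the domain. -/
theorem closure_eq_iUnion_hull : closure D.Ω = ⋃ τ : D.Cell, hull τ.basis := by
  apply subset_antisymm
  · refine closure_minimal (fun x hx => ?_) D.isClosed_iUnion_hull
    by_contra hx'
    have hopen : IsOpen (D.Ω \ ⋃ τ : D.Cell, hull τ.basis) :=
      D.isOpen_Ω.sdiff D.isClosed_iUnion_hull
    have hnull : volume (D.Ω \ ⋃ τ : D.Cell, hull τ.basis) = 0 := by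
      refine measure_mono_null (fun y hy => ?_) D.volume_lower_faces
      have hyK : y ∈ D.K.space := D.closure_Ω ▸ subset_closure hy.1
      obtain ⟨s, hs, hys⟩ := Geometry.SimplicialComplex.mem_space_iff.1 hyK
      refine mem_biUnion (x := s) ⟨hs, ?_⟩ hys
      by_contra hcard
      have : s.card = r + 1 := le_antisymm (card_le_of_mem_faces hs) (by omega)
      exact hy.2 (mem_iUnion.2 ⟨⟨s, hs, this⟩, by rwa [Cell.hull_eq]⟩)
    have := (hopen.measure_eq_zero_iff volume).1 hnull
    exact (this ▸ (⟨hx, hx'⟩ : x ∈ D.Ω \ ⋃ τ : D.Cell, hull τ.basis) : x ∈ (∅ : Set (Pt r)))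
  · refine iUnion_subset fun τ => ?_
    rw [D.closure_Ω, Cell.hull_eq]
    exact Geometry.SimplicialComplex.convexHull_subset_space τ.2.1

theorem exists_mem_hull {x : Pt r} (hx : x ∈ closure D.Ω) : ∃ τ : D.Cell, x ∈ hull τ.basis :=
  mem_iUnion.1 (D.closure_eq_iUnion_hull ▸ hx)

theorem hull_subset_closure (τ : D.Cell) : hull τ.basis ⊆ closure D.Ω :=
  D.closure_eq_iUnion_hull ▸ subset_iUnion (fun τ : D.Cell => hull τ.basis) τ

theorem volume_frontier : volume (frontier D.Ω) = 0 := by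
  refine measure_mono_null (fun x hx => ?_) D.volume_lower_faces
  obtain ⟨s, hs, hxs, hsub⟩ := D.frontier_Ω x hx
  refine mem_biUnion (x := s) ⟨hs, ?_⟩ hxs
  by_contra hcard
  have hc : s.card = r + 1 := le_antisymm (card_le_of_mem_faces hs) (by omega)
  obtain ⟨y, hy⟩ := nonempty_interior_hull (Cell.basis (D := D) ⟨s, hs, hc⟩)
  rw [Cell.hull_eq] at hy
  have hy' := interior_mono hsub hy
  rw [← frontier_compl, interior_frontier D.isOpen_Ω.isClosed_compl] at hy'
  exact hy'

theorem Ω_ae_eq : D.Ω =ᵐ[volume] (⋃ τ : D.Cell, hull τ.basis : Set (Pt r)) := by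
  rw [← D.closure_eq_iUnion_hull]
  exact (closure_ae_eq_of_null_frontier D.volume_frontier).symm

theorem aedisjoint_hull :
    Pairwise (Function.onFun (AEDisjoint volume) fun τ : D.Cell => hull τ.basis) := by
  classical
  intro τ τ' hne
  change volume (hull τ.basis ∩ hull τ'.basis) = 0
  rw [Cell.hull_eq, Cell.hull_eq, D.K.convexHull_inter_convexHull τ.2.1 τ'.2.1,
    ← Finset.coe_inter]
  refine volume_convexHull_eq_zero ?_
  have h1 : (τ.1 ∩ τ'.1).card ≤ r + 1 :=
    (Finset.card_le_card Finset.inter_subset_left).trans τ.2.2.le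
  by_contra h
  have h2 : (τ.1 ∩ τ'.1).card = r + 1 := by omega
  have h3 := Finset.eq_of_subset_of_card_le (Finset.inter_subset_left (s₁ := τ.1) (s₂ := τ'.1))
    (by rw [h2, τ.2.2])
  have h4 := Finset.eq_of_subset_of_card_le (Finset.inter_subset_right (s₁ := τ.1) (s₂ := τ'.1))
    (by rw [h2, τ'.2.2])
  exact hne (Subtype.ext (h3.symm.trans h4))

open Classical in
theorem setIntegral_region {S : Set (Finset (Pt r))} (hS : S ⊆ cells D.K) {f : Pt r → ℝ}
    (hf : ∀ τ : D.Cell, τ.1 ∈ S → IntegrableOn f (hull τ.basis)) :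
    ∫ x in region S, f x = ∑ τ : D.Cell with τ.1 ∈ S, ∫ x in hull τ.basis, f x := by
  have hreg : region S = ⋃ τ : {τ : D.Cell // τ.1 ∈ S}, hull τ.1.basis := by
    ext x
    simp only [region, mem_iUnion, Cell.hull_eq]
    constructor
    · rintro ⟨s, hs, hx⟩
      exact ⟨⟨⟨s, hS hs⟩, hs⟩, hx⟩
    · rintro ⟨τ, hx⟩
      exact ⟨τ.1.1, τ.2, hx⟩
  rw [hreg, integral_iUnion_ae (s := fun τ : {τ : D.Cell // τ.1 ∈ S} => hull τ.1.basis) (fun τ => (measurableSet_hull _).nullMeasurableSet)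
    (fun _ _ h => D.aedisjoint_hull (Subtype.coe_injective.ne h))
    (integrableOn_finite_iUnion.2 fun τ => hf τ.1 τ.2), tsum_fintype]
  exact (Finset.sum_subtype (Finset.univ.filter fun τ : D.Cell => τ.1 ∈ S) (by simp)
    fun τ => ∫ x in hull τ.basis, f x).symm

theorem setIntegral_Ω {f : Pt r → ℝ} (hf : ∀ τ : D.Cell, IntegrableOn f (hull τ.basis)) :
    ∫ x in D.Ω, f x = ∑ τ : D.Cell, ∫ x in hull τ.basis, f x := by
  rw [setIntegral_congr_set D.Ω_ae_eq, integral_iUnion_ae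
    (fun τ => (measurableSet_hull _).nullMeasurableSet) D.aedisjoint_hull
    (integrableOn_finite_iUnion.2 hf), tsum_fintype]

variable {D}

theorem mem_vertices_of_mem_cell (τ : D.Cell) {x : Pt r} (hx : x ∈ τ.1) : x ∈ D.K.vertices := by
  rw [Geometry.SimplicialComplex.vertices_eq]
  exact mem_biUnion τ.2.1 hx

theorem mem_closure_of_mem_vertices {x : Pt r} (hx : x ∈ D.K.vertices) : x ∈ closure D.Ω := by
  rw [D.closure_Ω]
  exact Geometry.SimplicialComplex.subset_space hx (by simp)

theorem exists_cell_of_mem_vertices {x : Pt r} (hx : x ∈ D.K.vertices) :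
    ∃ τ : D.Cell, x ∈ τ.1 := by
  obtain ⟨τ, hτ⟩ := D.exists_mem_hull (mem_closure_of_mem_vertices hx)
  refine ⟨τ, ?_⟩
  rw [Cell.hull_eq] at hτ
  have := D.K.inter_subset_convexHull τ.2.1 hx ⟨hτ, subset_convexHull ℝ _ (by simp)⟩
  obtain ⟨y, hy, hy'⟩ := convexHull_nonempty_iff.1 ⟨_, this⟩
  rwa [← Finset.mem_singleton.1 hy']

variable (D) in
theorem finite_vertices : D.K.vertices.Finite := by
  rw [Geometry.SimplicialComplex.vertices_eq]
  exact D.finite_faces.biUnion fun s _ => s.finite_toSet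

variable (D) in
theorem nonempty_cell : Nonempty D.Cell := by
  obtain ⟨x, hx⟩ := D.isConnected_Ω.nonempty
  exact ⟨(D.exists_mem_hull (subset_closure hx)).choose⟩

theorem eqOn_interp {v : Pt r → ℝ} {τ : D.Cell} {A : Pt r →ᵃ[ℝ] ℝ}
    (hA : EqOn v A (convexHull ℝ (τ.1 : Set (Pt r)))) :
    EqOn v (interp τ.basis v) (hull τ.basis) := by
  rw [← Cell.hull_eq] at hA
  rw [interp_eq τ.basis fun i => hA (vertex_mem_hull _ i)]
  exact hA

theorem AffineOnCells.eqOn_interp {v : Pt r → ℝ} (hv : AffineOnCells D.K v) (τ : D.Cell) :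
    EqOn v (interp τ.basis v) (hull τ.basis) := by
  obtain ⟨A, hA⟩ := hv τ.1 τ.2
  exact Setting.eqOn_interp hA

theorem eqOn_interp_of_mem_Vh {v : Pt r → ℝ} (hv : v ∈ D.Vh) (τ : D.Cell) :
    EqOn v (interp τ.basis v) (hull τ.basis) :=
  AffineOnCells.eqOn_interp hv.2.1 τ

theorem interp_congr {v w : Pt r → ℝ} {τ : D.Cell} (h : ∀ x ∈ τ.1, v x = w x) :
    interp τ.basis v = interp τ.basis w :=
  interp_eq _ fun i => by rw [interp_vertex]; exact h i.1 i.2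

theorem gradOn_congr {v w : Pt r → ℝ} {τ : D.Cell} (h : ∀ x ∈ τ.1, v x = w x) :
    gradOn τ.basis v = gradOn τ.basis w := by
  simp [gradOn, interp_congr h]

/-! ### Nodal interpolation -/

/-- Interpolants on two elements agree where the elements meet. -/
theorem interp_eq_interp (f : Pt r → ℝ) {τ τ' : D.Cell} {x : Pt r} (hx : x ∈ hull τ.basis)
    (hx' : x ∈ hull τ'.basis) : interp τ.basis f x = interp τ'.basis f x := by
  rw [Cell.hull_eq] at hx hx'
  refine eqOn_convexHull_of_eqOn (fun y hy => ?_)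
    (D.K.inter_subset_convexHull τ.2.1 τ'.2.1 ⟨hx, hx'⟩)
  have h1 := interp_vertex τ.basis f ⟨y, hy.1⟩
  have h2 := interp_vertex τ'.basis f ⟨y, hy.2⟩
  rw [Cell.basis_apply] at h1 h2
  exact h1.trans h2.symm

/-- Vertex data that vanish at the boundary vertices are interpolated by zero on the boundary,
because the boundary is a union of faces. -/
theorem interp_eq_zero_of_mem_frontier {f : Pt r → ℝ} (hf : ∀ x ∈ D.K.vertices, x ∉ D.Ω → f x = 0)
    {τ : D.Cell} {x : Pt r} (hx : x ∈ hull τ.basis) (hx' : x ∈ frontier D.Ω) :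
    interp τ.basis f x = 0 := by
  obtain ⟨t, ht, hxt, hsub⟩ := D.frontier_Ω x hx'
  rw [Cell.hull_eq] at hx
  have h0 : EqOn (interp τ.basis f) (0 : Pt r →ᵃ[ℝ] ℝ) ((τ.1 : Set (Pt r)) ∩ t) := by
    intro y hy
    have h1 := interp_vertex τ.basis f ⟨y, hy.1⟩
    rw [Cell.basis_apply] at h1
    rw [h1]
    refine hf y (mem_vertices_of_mem_cell τ hy.1) fun hyΩ => ?_
    have hyf := hsub (subset_convexHull ℝ _ hy.2)
    rw [frontier, D.isOpen_Ω.interior_eq] at hyf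
    exact hyf.2 hyΩ
  exact eqOn_convexHull_of_eqOn h0 (D.K.inter_subset_convexHull τ.2.1 ht ⟨hx, hxt⟩)

theorem mem_frontier_of_notMem {x : Pt r} (hx : x ∈ closure D.Ω) (hx' : x ∉ D.Ω) :
    x ∈ frontier D.Ω := by
  rw [frontier, D.isOpen_Ω.interior_eq]
  exact ⟨hx, hx'⟩

/-- Vertex data vanishing at the boundary vertices extend to a finite element function. -/
theorem exists_mem_Vh_eq_on_vertices {f : Pt r → ℝ}
    (hf : ∀ x ∈ D.K.vertices, x ∉ D.Ω → f x = 0) :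
    ∃ w ∈ D.Vh, ∀ x ∈ D.K.vertices, w x = f x := by
  classical
  let w : Pt r → ℝ := fun x =>
    if h : x ∈ closure D.Ω then interp (D.exists_mem_hull h).choose.basis f x else 0
  have hw : ∀ τ : D.Cell, EqOn w (interp τ.basis f) (hull τ.basis) := by
    intro τ x hx
    have h := D.hull_subset_closure τ hx
    simp only [w, dif_pos h]
    exact interp_eq_interp f (D.exists_mem_hull h).choose_spec hx
  have hw0 : ∀ x ∉ D.Ω, w x = 0 := by
    intro x hx
    by_cases h : x ∈ closure D.Ω
    · obtain ⟨τ, hτ⟩ := D.exists_mem_hull h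
      rw [hw τ hτ]
      exact interp_eq_zero_of_mem_frontier hf hτ (mem_frontier_of_notMem h hx)
    · simp [w, h]
  refine ⟨w, ⟨?_, fun s hs => ⟨interp (Cell.basis ⟨s, hs⟩) f, ?_⟩, hw0⟩, fun x hx => ?_⟩
  · -- the closed elements and the complement of the domain form a finite closed cover
    let c : Option D.Cell → Set (Pt r) := fun o => o.elim D.Ωᶜ fun τ => hull τ.basis
    refine LocallyFinite.continuous (f := c) (locallyFinite_of_finite c) ?_ ?_ ?_
    · refine eq_univ_of_forall fun x => mem_iUnion.2 ?_
      by_cases h : x ∈ D.Ω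
      · obtain ⟨τ, hτ⟩ := D.exists_mem_hull (subset_closure h)
        exact ⟨some τ, hτ⟩
      · exact ⟨none, h⟩
    · rintro (_ | τ)
      · exact D.isOpen_Ω.isClosed_compl
      · exact (isCompact_hull τ.basis).isClosed
    · rintro (_ | τ)
      · exact continuousOn_const.congr fun x hx => hw0 x hx
      · exact (continuous_affine _).continuousOn.congr (hw τ)
  · have := hw ⟨s, hs⟩
    rwa [Cell.hull_eq] at this
  · obtain ⟨τ, hτ⟩ := exists_cell_of_mem_vertices hx
    have h1 := vertex_mem_hull τ.basis ⟨x, hτ⟩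
    have h2 := interp_vertex τ.basis f ⟨x, hτ⟩
    rw [Cell.basis_apply] at h1 h2
    rw [hw τ h1, h2]

theorem eq_zero_of_vertices {v : Pt r → ℝ} (hv : v ∈ D.Vh)
    (h : ∀ x ∈ D.K.vertices, v x = 0) : v = 0 := by
  ext x
  by_cases hx : x ∈ D.Ω
  · obtain ⟨τ, hτ⟩ := D.exists_mem_hull (subset_closure hx)
    rw [eqOn_interp_of_mem_Vh hv τ hτ, interp_apply]
    exact Finset.sum_eq_zero fun i _ => by
      rw [Cell.basis_apply, h _ (mem_vertices_of_mem_cell τ i.2), zero_mul]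
  · exact hv.2.2 x hx

instance : FiniteDimensional ℝ D.Vh := by
  have : Finite D.K.vertices := D.finite_vertices.to_subtype
  let L : D.Vh →ₗ[ℝ] (D.K.vertices → ℝ) :=
    { toFun := fun v x => (v : Pt r → ℝ) x
      map_add' := fun _ _ => rfl
      map_smul' := fun _ _ => rfl }
  refine FiniteDimensional.of_injective L ((injective_iff_map_eq_zero L).2 fun v hv => ?_)
  exact Subtype.ext (eq_zero_of_vertices v.2 fun x hx => congrFun hv ⟨x, hx⟩)

/-! ### The partition of unity -/

theorem θ_le_one (i : Fin D.N) {x : Pt r} (hx : x ∈ D.K.vertices) : D.θ i x ≤ 1 := by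
  have h1 : D.θ i x ≤ ∑ j, D.θ j x :=
    Finset.single_le_sum (fun j _ => D.θ_nonneg j x) (Finset.mem_univ i)
  by_cases h : x ∈ D.Ω
  · exact h1.trans (D.θ_sum x hx h).le
  · exact h1.trans (D.θ_sum_le x hx (mem_frontier_of_notMem (mem_closure_of_mem_vertices hx) h))

/-- If `θ i` vanishes at a point, it vanishes at the vertices of the face that carries the point, so
that every multiple interpolated at the vertices vanishes there too. -/
theorem interp_mul_eq_zero (i : Fin D.N) {e w : Pt r → ℝ} {τ : D.Cell}
    (hw : ∀ x ∈ τ.1, w x = D.θ i x * e x) {x : Pt r} (hx : x ∈ hull τ.basis)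
    (h0 : D.θ i x = 0) : interp τ.basis w x = 0 := by
  rw [AffineOnCells.eqOn_interp (D.θ_affine i) τ hx, interp_apply] at h0
  rw [interp_apply]
  refine Finset.sum_eq_zero fun j hj => ?_
  have := (Finset.sum_eq_zero_iff_of_nonneg fun j _ =>
    mul_nonneg (D.θ_nonneg i _) (coord_nonneg τ.basis hx j)).1 h0 j hj
  rw [Cell.basis_apply] at this ⊢
  rw [hw _ j.2, mul_right_comm, this, zero_mul]

theorem mem_V0_of_vertices (i : Fin D.N) {e w : Pt r → ℝ} (hwV : w ∈ D.Vh)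
    (hw : ∀ x ∈ D.K.vertices, w x = D.θ i x * e x) : w ∈ D.V0 i := by
  refine ⟨hwV, fun x hx => ?_⟩
  by_cases hxΩ : x ∈ D.Ω
  · -- `x` is a limit of points outside the closed region, and `θ i` is continuous at `x`
    have hcl : x ∈ closure (region (D.ext i))ᶜ := by rwa [closure_compl]
    have hcont : ContinuousAt (D.θ i) x := (D.θ_continuousOn i).continuousAt
      (Filter.mem_of_superset (D.isOpen_Ω.mem_nhds hxΩ) subset_closure)
    have h0 : D.θ i x = 0 := by
      have := mem_closure_iff_frequently.1 hcl
      by_contra hne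
      exact this (((hcont.eventually_ne hne)).mono fun y hy hy' => hy (D.θ_support i y hy'))
    obtain ⟨τ, hτ⟩ := D.exists_mem_hull (subset_closure hxΩ)
    rw [eqOn_interp_of_mem_Vh hwV τ hτ]
    exact interp_mul_eq_zero i (fun y hy => hw y (mem_vertices_of_mem_cell τ hy)) hτ h0
  · exact hwV.2.2 x hxΩ

/-- `θ i` vanishes on the elements outside `Ω_i'`, since their interiors are not covered. -/
theorem θ_eq_zero_of_notMem_ext (i : Fin D.N) {τ : D.Cell} (hτ : τ.1 ∉ D.ext i) :
    ∀ x ∈ τ.1, D.θ i x = 0 := by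
  have hnull : volume (hull τ.basis ∩ region (D.ext i)) = 0 := by
    have h1 : hull τ.basis ∩ region (D.ext i)
        ⊆ ⋃ τ' ∈ {τ' : D.Cell | τ' ≠ τ}, hull τ.basis ∩ hull τ'.basis := by
      rintro x ⟨hx, hx'⟩
      simp only [region, mem_iUnion] at hx'
      obtain ⟨s, hs, hxs⟩ := hx'
      refine mem_biUnion (x := ⟨s, D.ext_cells i hs⟩) ?_ ⟨hx, by rwa [Cell.hull_eq]⟩
      rintro rfl
      exact hτ hs
    exact measure_mono_null h1 ((measure_biUnion_null_iff (to_countable _)).2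
      fun τ' h => D.aedisjoint_hull (Ne.symm h))
  -- hence `θ i` vanishes almost everywhere on the element, and so at its vertices by continuity
  have hsub : interior (hull τ.basis) ⊆ closure (region (D.ext i))ᶜ := by
    intro x hx
    rw [closure_compl]
    intro hx'
    have hopen : IsOpen (interior (hull τ.basis) ∩ interior (region (D.ext i))) :=
      isOpen_interior.inter isOpen_interior
    have := (hopen.measure_eq_zero_iff volume).1 (measure_mono_null
      (inter_subset_inter interior_subset interior_subset) hnull)
    exact (this ▸ (⟨hx, hx'⟩ : x ∈ interior (hull τ.basis) ∩ interior (region (D.ext i))) :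
      x ∈ (∅ : Set (Pt r)))
  have hθ := AffineOnCells.eqOn_interp (D.θ_affine i) τ
  have hdense : hull τ.basis ⊆ closure (hull τ.basis \ region (D.ext i)) := by
    intro x hx
    have h1 : x ∈ closure (interior (hull τ.basis)) := by
      have hconv : Convex ℝ (hull τ.basis) := convex_convexHull ℝ _
      rw [hconv.closure_interior_eq_closure_of_nonempty_interior
        (nonempty_interior_hull τ.basis)]
      exact subset_closure hx
    rw [mem_closure_iff] at h1 ⊢
    intro o ho hxo
    obtain ⟨y, hyo, hyi⟩ := h1 o ho hxo
    obtain ⟨z, hz, hz'⟩ := mem_closure_iff.1 (hsub hyi) (o ∩ interior (hull τ.basis))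
      (ho.inter isOpen_interior) ⟨hyo, hyi⟩
    exact ⟨z, hz.1, interior_subset hz.2, hz'⟩
  have hzero : EqOn (interp τ.basis (D.θ i)) 0 (closure (hull τ.basis \ region (D.ext i))) := by
    refine EqOn.closure (fun y hy => ?_) (continuous_affine _) continuous_const
    rw [← hθ hy.1]
    exact D.θ_support i y hy.2
  intro x hx
  have h1 := vertex_mem_hull τ.basis ⟨x, hx⟩
  rw [Cell.basis_apply] at h1
  rw [hθ h1]
  exact hzero (hdense h1)

/-! ### The forms as finite sums over the elements -/

/-- The energy on an element of the affine functions with the given vertex values. -/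
def energyForm (τ : D.Cell) : (Pt r → ℝ) →ₗ[ℝ] (Pt r → ℝ) →ₗ[ℝ] ℝ :=
  LinearMap.mk₂ ℝ
    (fun v w => (∫ x in hull τ.basis, D.ρ x) * inner ℝ (gradOn τ.basis v) (gradOn τ.basis w))
    (fun v v' w => by rw [map_add, inner_add_left, mul_add])
    (fun c v w => by rw [map_smul, real_inner_smul_left, smul_eq_mul]; ring)
    (fun v w w' => by rw [map_add, inner_add_right, mul_add])
    (fun c v w => by rw [map_smul, real_inner_smul_right, smul_eq_mul]; ring)

theorem energyForm_apply (τ : D.Cell) (v w : Pt r → ℝ) : energyForm τ v w =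
    (∫ x in hull τ.basis, D.ρ x) * inner ℝ (gradOn τ.basis v) (gradOn τ.basis w) := rfl

theorem integrableOn_mul_interp {τ : D.Cell} (hρ : IntegrableOn D.ρ (hull τ.basis))
    (v w : Pt r → ℝ) :
    IntegrableOn (fun x => D.ρ x * (interp τ.basis v x * interp τ.basis w x)) (hull τ.basis) :=
  hρ.mul_continuousOn ((continuous_affine _).mul (continuous_affine _)).continuousOn
    (isCompact_hull _)

/-- The `ρ`-weighted inner product on an element of the affine functions with the given vertex
values. -/
def massForm (τ : D.Cell) (hρ : IntegrableOn D.ρ (hull τ.basis)) :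
    (Pt r → ℝ) →ₗ[ℝ] (Pt r → ℝ) →ₗ[ℝ] ℝ :=
  LinearMap.mk₂ ℝ
    (fun v w => ∫ x in hull τ.basis, D.ρ x * (interp τ.basis v x * interp τ.basis w x))
    (fun v v' w => by
      rw [← integral_add (integrableOn_mul_interp hρ v w) (integrableOn_mul_interp hρ v' w)]
      congr 1
      ext x
      simp only [map_add, AffineMap.coe_add, Pi.add_apply]
      ring)
    (fun c v w => by
      rw [smul_eq_mul, ← integral_const_mul]
      congr 1
      ext x
      simp only [map_smul, AffineMap.coe_smul, Pi.smul_apply, smul_eq_mul]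
      ring)
    (fun v w w' => by
      rw [← integral_add (integrableOn_mul_interp hρ v w) (integrableOn_mul_interp hρ v w')]
      congr 1
      ext x
      simp only [map_add, AffineMap.coe_add, Pi.add_apply]
      ring)
    (fun c v w => by
      rw [smul_eq_mul, ← integral_const_mul]
      congr 1
      ext x
      simp only [map_smul, AffineMap.coe_smul, Pi.smul_apply, smul_eq_mul]
      ring)

theorem massForm_apply {τ : D.Cell} (hρ : IntegrableOn D.ρ (hull τ.basis)) (v w : Pt r → ℝ) :
    massForm τ hρ v w =
      ∫ x in hull τ.basis, D.ρ x * (interp τ.basis v x * interp τ.basis w x) := rfl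

/-- The constant value on an element of the weight of `s k`. -/
def weight (k : Fin D.N) (τ : D.Cell) : ℝ := ∑ l ∈ D.nbr k, ‖gradOn τ.basis (D.θ l)‖ ^ 2

variable (D) in
/-- The form `a`, extended to all functions through their vertex values. -/
def energy : (Pt r → ℝ) →ₗ[ℝ] (Pt r → ℝ) →ₗ[ℝ] ℝ := ∑ τ : D.Cell, energyForm τ

open Classical in
/-- The form `a_k`, extended to all functions through their vertex values. -/
def aForm (k : Fin D.N) : (Pt r → ℝ) →ₗ[ℝ] (Pt r → ℝ) →ₗ[ℝ] ℝ :=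
  ∑ τ : D.Cell with τ.1 ∈ D.sub k, energyForm τ

open Classical in
/-- The form `s_k`, extended to all functions through their vertex values. -/
def sForm (hρ : ∀ τ : D.Cell, IntegrableOn D.ρ (hull τ.basis)) (k : Fin D.N) :
    (Pt r → ℝ) →ₗ[ℝ] (Pt r → ℝ) →ₗ[ℝ] ℝ :=
  ∑ τ : D.Cell with τ.1 ∈ D.sub k, weight k τ • massForm τ (hρ τ)

theorem energy_apply (v w : Pt r → ℝ) : D.energy v w = ∑ τ : D.Cell, energyForm τ v w := by
  simp [energy, LinearMap.sum_apply]

open Classical in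
theorem aForm_apply (k : Fin D.N) (v w : Pt r → ℝ) :
    aForm k v w = ∑ τ : D.Cell with τ.1 ∈ D.sub k, energyForm τ v w := by
  simp [aForm, LinearMap.sum_apply]

open Classical in
theorem sForm_apply (hρ : ∀ τ : D.Cell, IntegrableOn D.ρ (hull τ.basis)) (k : Fin D.N)
    (v w : Pt r → ℝ) :
    sForm hρ k v w = ∑ τ : D.Cell with τ.1 ∈ D.sub k, weight k τ * massForm τ (hρ τ) v w := by
  simp [sForm, LinearMap.sum_apply]

theorem energyForm_symm (τ : D.Cell) (v w : Pt r → ℝ) : energyForm τ v w = energyForm τ w v := by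
  rw [energyForm_apply, energyForm_apply, real_inner_comm]

theorem energy_symm (v w : Pt r → ℝ) : D.energy v w = D.energy w v := by
  simp only [energy_apply, energyForm_symm _ v w]

theorem aForm_symm (k : Fin D.N) (v w : Pt r → ℝ) : aForm k v w = aForm k w v := by
  simp only [aForm_apply, energyForm_symm _ v w]

theorem sForm_symm (hρ : ∀ τ : D.Cell, IntegrableOn D.ρ (hull τ.basis)) (k : Fin D.N)
    (v w : Pt r → ℝ) : sForm hρ k v w = sForm hρ k w v := by
  simp only [sForm_apply, massForm_apply, mul_comm (interp _ v _)]

theorem weight_nonneg (k : Fin D.N) (τ : D.Cell) : 0 ≤ weight k τ :=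
  Finset.sum_nonneg fun _ _ => sq_nonneg _

theorem aForm_congr (k : Fin D.N) {v v' : Pt r → ℝ}
    (h : ∀ τ : D.Cell, τ.1 ∈ D.sub k → ∀ x ∈ τ.1, v x = v' x) (w : Pt r → ℝ) :
    aForm k w v = aForm k w v' := by
  classical
  simp only [aForm_apply, energyForm_apply]
  refine Finset.sum_congr rfl fun τ hτ => ?_
  rw [gradOn_congr (h τ (Finset.mem_filter.1 hτ).2)]

theorem sForm_congr (hρ : ∀ τ : D.Cell, IntegrableOn D.ρ (hull τ.basis)) (k : Fin D.N)
    {v v' : Pt r → ℝ} (h : ∀ τ : D.Cell, τ.1 ∈ D.sub k → ∀ x ∈ τ.1, v x = v' x) (w : Pt r → ℝ) :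
    sForm hρ k w v = sForm hρ k w v' := by
  classical
  simp only [sForm_apply, massForm_apply]
  refine Finset.sum_congr rfl fun τ hτ => ?_
  rw [interp_congr (h τ (Finset.mem_filter.1 hτ).2)]

open Classical in
theorem sum_sub_eq_sum (g : D.Cell → ℝ) :
    ∑ k, ∑ τ : D.Cell with τ.1 ∈ D.sub k, g τ = ∑ τ, g τ := by
  simp only [Finset.sum_filter]
  rw [Finset.sum_comm]
  refine Finset.sum_congr rfl fun τ _ => ?_
  obtain ⟨k, hk, huniq⟩ := D.sub_partition τ.1 τ.2
  rw [Finset.sum_eq_single k (fun j _ hj => if_neg fun h => hj (huniq j h)) (by simp), if_pos hk]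

theorem sum_aForm (v w : Pt r → ℝ) : ∑ k : Fin D.N, aForm k v w = D.energy v w := by
  classical
  simp only [aForm_apply, energy_apply]
  exact sum_sub_eq_sum fun τ => energyForm τ v w

/-! ### Agreement with the integrals -/

/-- The functions that are affine on each element of the subdomain `Ω_k`. -/
def affineOnSub (k : Fin D.N) : Submodule ℝ (Pt r → ℝ) where
  carrier := {v | ∀ τ : D.Cell, τ.1 ∈ D.sub k → EqOn v (interp τ.basis v) (hull τ.basis)}
  zero_mem' := fun τ _ x _ => by simp
  add_mem' := fun hv hw τ hτ x hx => by simp [← hv τ hτ hx, ← hw τ hτ hx]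
  smul_mem' := fun c v hv τ hτ x hx => by simp [← hv τ hτ hx]

theorem mem_affineOnSub_of_mem_Vh (k : Fin D.N) {v : Pt r → ℝ} (hv : v ∈ D.Vh) :
    v ∈ affineOnSub k := fun τ _ => eqOn_interp_of_mem_Vh hv τ

theorem subset_region {k : Fin D.N} {τ : D.Cell} (hτ : τ.1 ∈ D.sub k) :
    hull τ.basis ⊆ region (D.sub k) := by
  rw [Cell.hull_eq]
  exact subset_biUnion_of_mem (u := fun s : Finset (Pt r) => convexHull ℝ (s : Set (Pt r))) hτ

theorem eq_on_vertices_of_eqOn_region {k : Fin D.N} {v w : Pt r → ℝ}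
    (h : EqOn v w (region (D.sub k))) (τ : D.Cell) (hτ : τ.1 ∈ D.sub k) :
    ∀ x ∈ τ.1, v x = w x :=
  fun x hx => h (subset_region hτ (vertex_mem_hull τ.basis ⟨x, hx⟩))

theorem mem_affineOnSub_of_mem_Vsub {k : Fin D.N} {v : Pt r → ℝ} (hv : v ∈ D.Vsub k) :
    v ∈ affineOnSub k := by
  obtain ⟨w, hw, hvw⟩ := hv
  intro τ hτ
  have h := eqOn_interp_of_mem_Vh hw τ
  rw [interp_congr (eq_on_vertices_of_eqOn_region hvw τ hτ)]
  exact (hvw.mono (subset_region hτ)).trans h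

theorem energy_integrand {τ : D.Cell} {v w : Pt r → ℝ}
    (hv : EqOn v (interp τ.basis v) (hull τ.basis))
    (hw : EqOn w (interp τ.basis w) (hull τ.basis)) :
    ∀ x ∈ interior (hull τ.basis), D.ρ x * inner ℝ (∇ v x) (∇ w x)
      = D.ρ x * inner ℝ (gradOn τ.basis v) (gradOn τ.basis w) := by
  intro x hx
  rw [gradient_eq_gradOn _ hv hx, gradient_eq_gradOn _ hw hx]

theorem s_integrand (k : Fin D.N) {τ : D.Cell} {v w : Pt r → ℝ}
    (hv : EqOn v (interp τ.basis v) (hull τ.basis))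
    (hw : EqOn w (interp τ.basis w) (hull τ.basis)) :
    ∀ x ∈ interior (hull τ.basis), D.ρ x * (∑ l ∈ D.nbr k, ‖∇ (D.θ l) x‖ ^ 2) * v x * w x
      = weight k τ * (D.ρ x * (interp τ.basis v x * interp τ.basis w x)) := by
  intro x hx
  have h1 : ∑ l ∈ D.nbr k, ‖∇ (D.θ l) x‖ ^ 2 = weight k τ :=
    Finset.sum_congr rfl fun l _ => by
      rw [gradient_eq_gradOn _ (AffineOnCells.eqOn_interp (D.θ_affine l) τ) hx]
  rw [h1, hv (interior_subset hx), hw (interior_subset hx)]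
  ring

theorem a_eq_energy (hρ : ∀ τ : D.Cell, IntegrableOn D.ρ (hull τ.basis))
    {v w : Pt r → ℝ} (hv : v ∈ D.Vh) (hw : w ∈ D.Vh) :
    D.a v w = D.energy v w := by
  have h := fun τ : D.Cell =>
    energy_integrand (eqOn_interp_of_mem_Vh hv τ) (eqOn_interp_of_mem_Vh hw τ)
  rw [a, setIntegral_Ω D fun τ => integrableOn_hull_congr _ (h τ) ((hρ τ).mul_const _),
    energy_apply]
  refine Finset.sum_congr rfl fun τ _ => ?_
  rw [setIntegral_hull_congr _ (h τ), integral_mul_const, energyForm_apply]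

theorem aSub_eq_aForm (hρ : ∀ τ : D.Cell, IntegrableOn D.ρ (hull τ.basis)) {k : Fin D.N}
    {v w : Pt r → ℝ} (hv : v ∈ affineOnSub k)
    (hw : w ∈ affineOnSub k) : D.aSub k v w = aForm k v w := by
  classical
  have h := fun (τ : D.Cell) (hτ : τ.1 ∈ D.sub k) => energy_integrand (hv τ hτ) (hw τ hτ)
  rw [aSub, setIntegral_region D (D.sub_cells k)
    fun τ hτ => integrableOn_hull_congr _ (h τ hτ) ((hρ τ).mul_const _), aForm_apply]
  refine Finset.sum_congr rfl fun τ hτ => ?_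
  rw [setIntegral_hull_congr _ (h τ (Finset.mem_filter.1 hτ).2), integral_mul_const,
    energyForm_apply]

theorem s_eq_sForm (hρ : ∀ τ : D.Cell, IntegrableOn D.ρ (hull τ.basis)) {k : Fin D.N}
    {v w : Pt r → ℝ} (hv : v ∈ affineOnSub k) (hw : w ∈ affineOnSub k) : D.s k v w = sForm hρ k v w := by
  classical
  have h := fun (τ : D.Cell) (hτ : τ.1 ∈ D.sub k) => s_integrand k (hv τ hτ) (hw τ hτ)
  rw [s, setIntegral_region D (D.sub_cells k) fun τ hτ => integrableOn_hull_congr _ (h τ hτ)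
    ((integrableOn_mul_interp (hρ τ) v w).const_mul _), sForm_apply]
  refine Finset.sum_congr rfl fun τ hτ => ?_
  rw [setIntegral_hull_congr _ (h τ (Finset.mem_filter.1 hτ).2), integral_const_mul,
    massForm_apply]

/-! ### Definiteness -/

theorem Resolves.integrableOn {κ : ℝ} (h : D.Resolves κ) (τ : D.Cell) :
    IntegrableOn D.ρ (hull τ.basis) := by
  obtain ⟨m, hm, hae⟩ := h τ.1 τ.2
  rw [← Cell.hull_eq] at hae
  refine Measure.integrableOn_of_bounded (M := κ * m) (isCompact_hull _).measure_lt_top.ne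
    D.ρ_measurable.aestronglyMeasurable ?_
  filter_upwards [hae] with x hx
  rw [Real.norm_of_nonneg (hm.le.trans hx.1)]
  exact hx.2

theorem Resolves.integral_pos {κ : ℝ} (h : D.Resolves κ) (τ : D.Cell) :
    0 < ∫ x in hull τ.basis, D.ρ x := by
  obtain ⟨m, hm, hae⟩ := h τ.1 τ.2
  rw [← Cell.hull_eq, ae_restrict_iff' (measurableSet_hull _)] at hae
  calc 0 < volume.real (hull τ.basis) * m := mul_pos (volume_hull_pos _) hm
    _ = ∫ _x in hull τ.basis, m := by rw [setIntegral_const, smul_eq_mul]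
    _ ≤ _ := setIntegral_mono_on_ae (integrableOn_const (isCompact_hull _).measure_lt_top.ne)
        (h.integrableOn τ) (measurableSet_hull _) (hae.mono fun x hx hxτ => (hx hxτ).1)

theorem Resolves.energyForm_nonneg {κ : ℝ} (h : D.Resolves κ) (τ : D.Cell) (v : Pt r → ℝ) :
    0 ≤ energyForm τ v v := by
  rw [energyForm_apply]
  exact mul_nonneg (h.integral_pos τ).le real_inner_self_nonneg

theorem Resolves.massForm_nonneg {κ : ℝ} (h : D.Resolves κ) (τ : D.Cell) (v : Pt r → ℝ) :
    0 ≤ massForm τ (h.integrableOn τ) v v := by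
  obtain ⟨m, hm, hae⟩ := h τ.1 τ.2
  rw [← Cell.hull_eq] at hae
  refine setIntegral_nonneg_of_ae_restrict ?_
  filter_upwards [hae] with x hx
  exact mul_nonneg (hm.le.trans hx.1) (mul_self_nonneg _)

theorem Resolves.energy_nonneg {κ : ℝ} (h : D.Resolves κ) (v : Pt r → ℝ) : 0 ≤ D.energy v v := by
  rw [energy_apply]
  exact Finset.sum_nonneg fun τ _ => h.energyForm_nonneg τ v

theorem Resolves.aForm_nonneg {κ : ℝ} (h : D.Resolves κ) (k : Fin D.N) (v : Pt r → ℝ) :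
    0 ≤ aForm k v v := by
  rw [aForm_apply]
  exact Finset.sum_nonneg fun τ _ => h.energyForm_nonneg τ v

theorem Resolves.sForm_nonneg {κ : ℝ} (h : D.Resolves κ) (k : Fin D.N) (v : Pt r → ℝ) :
    0 ≤ sForm h.integrableOn k v v := by
  rw [sForm_apply]
  exact Finset.sum_nonneg fun τ _ => mul_nonneg (weight_nonneg k τ) (h.massForm_nonneg τ v)

/-- A finite element function of zero energy takes finitely many values, one per element and zero.
Being continuous on the connected space it is constant, and it vanishes off a bounded set. -/
theorem Resolves.eq_zero_of_energy_eq_zero (hr : 0 < r) {κ : ℝ} (h : D.Resolves κ) {v : Pt r → ℝ}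
    (hv : v ∈ D.Vh) (h0 : D.energy v v = 0) : v = 0 := by
  rw [energy_apply] at h0
  have hgrad : ∀ τ : D.Cell, gradOn τ.basis v = 0 := by
    intro τ
    have := (Finset.sum_eq_zero_iff_of_nonneg fun τ _ => h.energyForm_nonneg τ v).1 h0 τ
      (Finset.mem_univ τ)
    rw [energyForm_apply, mul_eq_zero] at this
    exact inner_self_eq_zero.1 (this.resolve_left (h.integral_pos τ).ne')
  have hfin : (range v).Finite := by
    refine ((finite_singleton (0 : ℝ)).union
      (finite_range fun τ : D.Cell => interp τ.basis v 0)).subset ?_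
    rintro _ ⟨x, rfl⟩
    by_cases hx : x ∈ D.Ω
    · obtain ⟨τ, hτ⟩ := D.exists_mem_hull (subset_closure hx)
      refine Or.inr ⟨τ, ?_⟩
      have h1 := affine_sub_eq_inner (interp τ.basis v) x 0
      have h2 : affineGrad (interp τ.basis v) = 0 := hgrad τ
      rw [h2, inner_zero_left, sub_eq_zero] at h1
      rw [eqOn_interp_of_mem_Vh hv τ hτ]
      exact h1.symm
    · exact Or.inl (hv.2.2 x hx)
  have hsub : (range v).Subsingleton :=
    hfin.countable.isTotallyDisconnected _ subset_rfl (isPreconnected_range hv.1)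
  have hbdd : Bornology.IsBounded D.Ω := by
    refine Bornology.IsBounded.subset ?_ subset_closure
    rw [D.closure_eq_iUnion_hull]
    exact (Bornology.isBounded_iUnion).2 fun τ => (isCompact_hull τ.basis).isBounded
  have : Nonempty (Fin r) := ⟨⟨0, hr⟩⟩
  obtain ⟨y, hy⟩ : ∃ y, y ∉ D.Ω := by
    by_contra! hall
    exact NormedSpace.unbounded_univ ℝ (Pt r) (eq_univ_of_forall hall ▸ hbdd)
  ext x
  rw [hsub (mem_range_self x) (mem_range_self y), hv.2.2 y hy]
  rfl

/-! ### The eigenvectors and the coarse space -/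

section Eigen

variable (S : D.EigenSystem) (Λ : ℝ)

/-- Indices of the selected eigenvectors on `Ω_k`. -/
abbrev Sel (k : Fin D.N) := {j : Fin (S.num k) // S.eig k j < Λ}

variable {S Λ}

theorem φ_mem (k : Fin D.N) (j : Fin (S.num k)) : S.φ k j ∈ affineOnSub k :=
  mem_affineOnSub_of_mem_Vsub (S.eigenpair k j).1

theorem sForm_φ (hρ : ∀ τ : D.Cell, IntegrableOn D.ρ (hull τ.basis)) (k : Fin D.N)
    (i j : Fin (S.num k)) : sForm hρ k (S.φ k i) (S.φ k j) = if i = j then 1 else 0 := by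
  rw [← s_eq_sForm hρ (φ_mem k i) (φ_mem k j)]
  split_ifs with h
  · rw [h]
    exact (S.eigenpair k j).2.1
  · exact S.orthogonal k i j h

theorem aForm_φ (hρ : ∀ τ : D.Cell, IntegrableOn D.ρ (hull τ.basis)) (k : Fin D.N)
    (j : Fin (S.num k)) {w : Pt r → ℝ} (hw : w ∈ D.Vh) :
    aForm k (S.φ k j) w = S.eig k j * sForm hρ k (S.φ k j) w := by
  rw [← s_eq_sForm hρ (φ_mem k j) (mem_affineOnSub_of_mem_Vh k hw),
    ← aSub_eq_aForm hρ (φ_mem k j) (mem_affineOnSub_of_mem_Vh k hw)]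
  exact (S.eigenpair k j).2.2 w ⟨w, hw, fun _ _ => rfl⟩

/-- Completeness of the eigensystem: a normalized eigenvector with eigenvalue below `Λ` is not
orthogonal to all selected eigenvectors. -/
theorem exists_sForm_ne_zero (hρ : ∀ τ : D.Cell, IntegrableOn D.ρ (hull τ.basis)) (k : Fin D.N)
    {f : Pt r → ℝ} (hf : f ∈ D.Vh) {μ : ℝ} (hμ : μ < Λ) (hf1 : sForm hρ k f f = 1)
    (heig : ∀ w ∈ D.Vh, aForm k f w = μ * sForm hρ k f w) :
    ∃ j : Sel S Λ k, sForm hρ k f (S.φ k j) ≠ 0 := by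
  have hfa := mem_affineOnSub_of_mem_Vh k hf
  have hpair : D.IsEigenpair k μ f := by
    refine ⟨⟨f, hf, fun _ _ => rfl⟩, by rw [s_eq_sForm hρ hfa hfa, hf1], fun w hw => ?_⟩
    have hwa := mem_affineOnSub_of_mem_Vsub hw
    obtain ⟨w', hw', hww'⟩ := hw
    rw [s_eq_sForm hρ hfa hwa, aSub_eq_aForm hρ hfa hwa,
      aForm_congr k (eq_on_vertices_of_eqOn_region hww'),
      sForm_congr hρ k (eq_on_vertices_of_eqOn_region hww')]
    exact heig w' hw'
  obtain ⟨c, hc⟩ := S.complete k μ f hpair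
  by_contra! hall
  -- the remaining eigenvectors belong to other eigenvalues, so they are orthogonal to `f` as well
  have hzero : ∀ j, sForm hρ k f (S.φ k j) = 0 := by
    intro j
    by_cases hj : S.eig k j < Λ
    · exact hall ⟨j, hj⟩
    obtain ⟨φ', hφ', hφφ'⟩ := (S.eigenpair k j).1
    have h1 := aForm_φ hρ k j hf
    have h2 := heig φ' hφ'
    rw [aForm_symm, aForm_congr k (eq_on_vertices_of_eqOn_region hφφ'), h2, sForm_symm hρ k _ f,
      ← sForm_congr hρ k (eq_on_vertices_of_eqOn_region hφφ')] at h1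
    have h3 : (μ - S.eig k j) * sForm hρ k f (S.φ k j) = 0 := by linarith
    exact (mul_eq_zero.1 h3).resolve_left (by linarith [not_lt.1 hj])
  have : sForm hρ k f f = 0 := by
    rw [sForm_congr hρ k (eq_on_vertices_of_eqOn_region hc) f, map_sum]
    exact Finset.sum_eq_zero fun j _ => by rw [map_smul, hzero, smul_zero]
  linarith

theorem Resolves.mul_sForm_le_aForm {κ : ℝ} (h : D.Resolves κ) (k : Fin D.N) {e : Pt r → ℝ}
    (he : e ∈ D.Vh) (horth : ∀ j : Sel S Λ k, sForm h.integrableOn k e (S.φ k j) = 0) :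
    Λ * sForm h.integrableOn k e e ≤ aForm k e e := by
  set hρ := h.integrableOn
  choose φ' hφ' hφφ' using fun j => (S.eigenpair k j).1
  have hφ := fun j => eq_on_vertices_of_eqOn_region (hφφ' j)
  have hs : ∀ v j, sForm hρ k v (φ' j) = sForm hρ k v (S.φ k j) :=
    fun v j => (sForm_congr hρ k (hφ j) v).symm
  have hs' : ∀ v j, sForm hρ k (φ' j) v = sForm hρ k (S.φ k j) v :=
    fun v j => by rw [sForm_symm, hs, sForm_symm]
  refine mul_form_le_of_orthogonal ((aForm k).domRestrict₁₂ D.Vh D.Vh)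
    ((sForm hρ k).domRestrict₁₂ D.Vh D.Vh) (fun v w => aForm_symm k v w)
    (fun v w => sForm_symm hρ k v w) (fun v => h.aForm_nonneg k v)
    (fun v => h.sForm_nonneg k v) (fun j : Sel S Λ k => ⟨φ' j, hφ' j⟩) (fun j => S.eig k j)
    (fun i j hij => ?_) (fun i => ?_) (fun i w => ?_) (fun f μ hμ hf1 hf => ?_) (e := ⟨e, he⟩)
    (fun j => ?_)
  · change sForm hρ k (φ' i) (φ' j) = 0
    rw [hs, hs', sForm_φ, if_neg fun hh => hij (Subtype.ext hh)]
  · change sForm hρ k (φ' i) (φ' i) = 1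
    rw [hs, hs', sForm_φ, if_pos rfl]
  · change aForm k (φ' i) w = S.eig k i * sForm hρ k (φ' i) w
    rw [hs', aForm_symm, ← aForm_congr k (hφ i), aForm_symm, aForm_φ hρ k i.1 w.2]
  · obtain ⟨j, hj⟩ := exists_sForm_ne_zero hρ k f.2 hμ hf1 fun w hw => hf ⟨w, hw⟩
    exact ⟨j, fun h0 => hj (by rw [← hs]; exact h0)⟩
  · exact (hs e j).trans (horth j)

theorem sForm_sum_smul_self (hρ : ∀ τ : D.Cell, IntegrableOn D.ρ (hull τ.basis)) (k : Fin D.N)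
    (c : Sel S Λ k → ℝ) :
    sForm hρ k (∑ j, c j • S.φ k j) (∑ j, c j • S.φ k j) = ∑ j, c j ^ 2 := by
  rw [map_sum]
  refine Finset.sum_congr rfl fun j _ => ?_
  rw [map_sum, LinearMap.sum_apply, Finset.sum_eq_single j]
  · rw [map_smul, map_smul, LinearMap.smul_apply, sForm_φ, if_pos rfl]
    simp [sq]
  · intro i _ hij
    rw [map_smul, map_smul, LinearMap.smul_apply, sForm_φ, if_neg fun hh => hij (Subtype.ext hh)]
    simp
  · simp

/-- The coefficient functional of a selected eigenvector on `V_h`. -/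
def coeff (hρ : ∀ τ : D.Cell, IntegrableOn D.ρ (hull τ.basis)) (m : Σ k, Sel S Λ k) :
    D.Vh →ₗ[ℝ] ℝ :=
  (sForm hρ m.1 (S.φ m.1 m.2)).domRestrict D.Vh

theorem coeff_apply (hρ : ∀ τ : D.Cell, IntegrableOn D.ρ (hull τ.basis)) (m : Σ k, Sel S Λ k)
    (v : D.Vh) : coeff hρ m v = sForm hρ m.1 (S.φ m.1 m.2) v := rfl

theorem proj_eq_sum (hρ : ∀ τ : D.Cell, IntegrableOn D.ρ (hull τ.basis)) (k : Fin D.N)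
    (ψ : D.Vh) : proj S Λ k ψ = ∑ j : Sel S Λ k, coeff hρ ⟨k, j⟩ ψ • S.φ k j := by
  rw [proj, Finset.sum_subtype (p := fun j => S.eig k j < Λ) _ (by simp)]
  refine Finset.sum_congr rfl fun j _ => ?_
  rw [coeff_apply, s_eq_sForm hρ (mem_affineOnSub_of_mem_Vh k ψ.2) (φ_mem k j.1), sForm_symm]

/-- In the coefficients of the selected eigenvectors the relaxed functional is the energy plus a
sum of squares. -/
theorem relaxedEnergy_eq (hρ : ∀ τ : D.Cell, IntegrableOn D.ρ (hull τ.basis)) (i : Fin D.N)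
    (j : Sel S Λ i) (ψ : D.Vh) [DecidableEq (Σ k, Sel S Λ k)] :
    relaxedEnergy S Λ i (S.φ i j) ψ = D.energy ψ ψ
      + ∑ m : Σ k, Sel S Λ k, (coeff hρ m ψ - if m = ⟨i, j⟩ then 1 else 0) ^ 2 := by
  classical
  have hs : ∀ (k : Fin D.N) (c : Sel S Λ k → ℝ),
      D.s k (∑ j, c j • S.φ k j) (∑ j, c j • S.φ k j) = ∑ j, c j ^ 2 := by
    intro k c
    have hmem : ∑ j, c j • S.φ k j ∈ affineOnSub k :=
      Submodule.sum_mem _ fun j _ => Submodule.smul_mem _ _ (φ_mem k j.1)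
    rw [s_eq_sForm hρ hmem hmem, sForm_sum_smul_self]
  have h1 : proj S Λ i ψ - S.φ i j
      = ∑ j', (coeff hρ ⟨i, j'⟩ ψ - if j' = j then 1 else 0) • S.φ i j' := by
    simp [sub_smul, Finset.sum_sub_distrib, proj_eq_sum hρ]
  rw [relaxedEnergy, a_eq_energy hρ ψ.2 ψ.2, h1, hs, Fintype.sum_sigma, add_assoc]
  congr 1
  rw [← Finset.add_sum_erase Finset.univ _ (Finset.mem_univ i)]
  congr 1
  · refine Finset.sum_congr rfl fun j' _ => ?_
    simp
  · rw [← Finset.filter_ne' Finset.univ i]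
    refine Finset.sum_congr rfl fun k hk => ?_
    rw [proj_eq_sum hρ, hs]
    refine Finset.sum_congr rfl fun j' _ => ?_
    rw [if_neg, sub_zero]
    intro h
    exact (Finset.mem_filter.1 hk).2 (congrArg Sigma.fst h)

theorem Vglb_le_Vh : Vglb S Λ ≤ D.Vh := Submodule.span_le.2 fun _ h => h.1

/-- A function that is energy-orthogonal to the coarse space is annihilated by the operators
`π_k`. -/
theorem Resolves.sForm_eq_zero_of_orthogonal (hr : 0 < r) {κ : ℝ} (h : D.Resolves κ)
    {e : Pt r → ℝ} (he : e ∈ D.Vh) (horth : ∀ v ∈ Vglb S Λ, D.energy v e = 0) (k : Fin D.N)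
    (j : Sel S Λ k) : sForm h.integrableOn k e (S.φ k j) = 0 := by
  classical
  rw [sForm_symm]
  refine functionals_eq_zero_of_orthogonal (D.energy.domRestrict₁₂ D.Vh D.Vh)
    (fun v => h.energy_nonneg v)
    (fun v hv => Subtype.ext (h.eq_zero_of_energy_eq_zero hr v.2 hv)) (coeff h.integrableOn)
    ((Vglb S Λ).comap D.Vh.subtype) (fun m ψ hψ => ?_) (e := ⟨e, he⟩) (fun v hv => horth v hv)
    ⟨k, j⟩
  refine Submodule.subset_span ⟨ψ.2, m.1, m.2.1, m.2.2, fun χ hχ => ?_⟩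
  change relaxedEnergy S Λ m.1 (S.φ m.1 m.2) ψ ≤ relaxedEnergy S Λ m.1 (S.φ m.1 m.2) χ
  rw [relaxedEnergy_eq h.integrableOn,
    show χ = ((⟨χ, hχ⟩ : D.Vh) : Pt r → ℝ) from rfl, relaxedEnergy_eq h.integrableOn]
  exact relaxed_functional_le (D.energy.domRestrict₁₂ D.Vh D.Vh) (fun v w => energy_symm (D := D) v w)
    (fun v => h.energy_nonneg v) (coeff h.integrableOn) hψ ⟨χ, hχ⟩

end Eigen

/-! ### The decomposition -/

theorem diam_hull_pos (hr : 0 < r) (τ : D.Cell) : 0 < Metric.diam (hull τ.basis) := by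
  obtain ⟨x, hx, y, hy, hxy⟩ := Finset.one_lt_card.1 (show 1 < τ.1.card by rw [τ.2.2]; omega)
  exact (dist_pos.2 hxy).trans_le (Metric.dist_le_diam_of_mem (isCompact_hull _).isBounded
    (vertex_mem_hull τ.basis ⟨x, hx⟩) (vertex_mem_hull τ.basis ⟨y, hy⟩))

/-- Each `θ l` that is not constant on an element of `Ω_k` has its index in `n(k)`. -/
theorem weight_eq_sum {k : Fin D.N} {τ : D.Cell} (hτ : τ.1 ∈ D.sub k) :
    weight k τ = ∑ l, ‖gradOn τ.basis (D.θ l)‖ ^ 2 := by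
  classical
  refine Finset.sum_subset (Finset.subset_univ _) fun l _ hl => ?_
  have h0 : ∀ x ∈ hull τ.basis, D.θ l x = 0 := by
    intro x hx
    by_contra hne
    exact hl (Finset.mem_filter.2 ⟨Finset.mem_univ l, x, subset_tsupport _ hne,
      subset_region hτ hx⟩)
  have h1 : gradOn τ.basis (D.θ l) = gradOn τ.basis 0 :=
    gradOn_congr fun x hx => h0 x (vertex_mem_hull τ.basis ⟨x, hx⟩)
  rw [h1, map_zero, norm_zero]
  simp

theorem sum_sForm_eq (hρ : ∀ τ : D.Cell, IntegrableOn D.ρ (hull τ.basis)) (e : Pt r → ℝ) :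
    ∑ k, sForm hρ k e e =
      ∑ τ : D.Cell, (∑ l, ‖gradOn τ.basis (D.θ l)‖ ^ 2) * massForm τ (hρ τ) e e := by
  classical
  rw [← sum_sub_eq_sum]
  refine Finset.sum_congr rfl fun k _ => ?_
  rw [sForm_apply]
  refine Finset.sum_congr rfl fun τ hτ => ?_
  rw [weight_eq_sum (Finset.mem_filter.1 hτ).2]

/-- The constant in the stability of interpolation of products on one element. -/
def stabConst (r : ℕ) (σ κ : ℝ) : ℝ := 2 * ((r + 1) * σ) ^ 2 * κ * 4 ^ (r + 1)

open Classical in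
theorem energyForm_piece_le (hr : 0 < r) {σ κ : ℝ} (hσ : 0 < σ) (hreg : D.ShapeRegular σ)
    (h : D.Resolves κ) (i : Fin D.N) {e w : Pt r → ℝ}
    (hw : ∀ x ∈ D.K.vertices, w x = D.θ i x * e x) (τ : D.Cell) :
    energyForm τ w w ≤ (if τ.1 ∈ D.ext i then 2 * energyForm τ e e else 0)
      + stabConst r σ κ * (‖gradOn τ.basis (D.θ i)‖ ^ 2 * massForm τ (h.integrableOn τ) e e) := by
  split_ifs with hτ
  · obtain ⟨m, hm, hae⟩ := h τ.1 τ.2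
    obtain ⟨c, hball⟩ := hreg τ.1 τ.2
    rw [← Cell.hull_eq] at hae hball
    have := energy_interp_mul_le τ.basis hσ hm hball (diam_hull_pos hr τ) (h.integrableOn τ) hae
      (θ := D.θ i) (e := e) (w := w) (fun x => D.θ_nonneg i _)
      (fun x => θ_le_one i (mem_vertices_of_mem_cell τ x.2))
      (fun x => hw _ (mem_vertices_of_mem_cell τ x.2))
    rw [energyForm_apply, energyForm_apply, real_inner_self_eq_norm_sq, real_inner_self_eq_norm_sq]
    exact this
  · have hθ := θ_eq_zero_of_notMem_ext i hτ
    have h1 : gradOn τ.basis w = gradOn τ.basis 0 := gradOn_congr fun x hx => by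
      rw [hw x (mem_vertices_of_mem_cell τ hx), hθ x hx, zero_mul]
      rfl
    have h2 : gradOn τ.basis (D.θ i) = gradOn τ.basis 0 := gradOn_congr hθ
    rw [energyForm_apply, h1, h2, map_zero, inner_zero_left]
    simp

theorem sum_energy_pieces_le (hr : 0 < r) {σ κ : ℝ} (hσ : 0 < σ) (hreg : D.ShapeRegular σ)
    (h : D.Resolves κ) {C : ℕ} (hC : D.OverlapAtMost C) {e : Pt r → ℝ} {w : Fin D.N → Pt r → ℝ}
    (hw : ∀ i, ∀ x ∈ D.K.vertices, w i x = D.θ i x * e x) :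
    ∑ i, D.energy (w i) (w i) ≤ 2 * C * D.energy e e
      + stabConst r σ κ * ∑ k, sForm h.integrableOn k e e := by
  classical
  have h1 : ∑ i, D.energy (w i) (w i) ≤ ∑ i, ∑ τ : D.Cell,
      ((if τ.1 ∈ D.ext i then 2 * energyForm τ e e else 0) + stabConst r σ κ *
        (‖gradOn τ.basis (D.θ i)‖ ^ 2 * massForm τ (h.integrableOn τ) e e)) := by
    refine Finset.sum_le_sum fun i _ => ?_
    rw [energy_apply]
    exact Finset.sum_le_sum fun τ _ => energyForm_piece_le hr hσ hreg h i (hw i) τ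
  refine h1.trans ?_
  rw [Finset.sum_comm, energy_apply, sum_sForm_eq, Finset.mul_sum, Finset.mul_sum,
    ← Finset.sum_add_distrib]
  refine Finset.sum_le_sum fun τ _ => ?_
  rw [Finset.sum_add_distrib, ← Finset.mul_sum, ← Finset.sum_mul]
  refine add_le_add ?_ le_rfl
  have hcount : ((Finset.univ.filter fun i => τ.1 ∈ D.ext i).card : ℝ) ≤ C := by
    have := hC τ.1 τ.2
    rw [Set.ncard_eq_toFinset_card', Set.toFinset_ofPred] at this
    exact_mod_cast this
  rw [← Finset.sum_filter, Finset.sum_const, nsmul_eq_mul]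
  have := h.energyForm_nonneg τ e
  nlinarith

theorem OverlapAtMost.one_le {C : ℕ} (hC : D.OverlapAtMost C) : 1 ≤ C := by
  obtain ⟨τ⟩ := D.nonempty_cell
  obtain ⟨i, hi, -⟩ := D.sub_partition τ.1 τ.2
  exact ((Set.ncard_pos (toFinite _)).2 ⟨i, D.sub_ext i hi⟩ : 0 < _).trans_le (hC τ.1 τ.2)

theorem eq_sum_pieces {e : Pt r → ℝ} (he : e ∈ D.Vh) {w : Fin D.N → Pt r → ℝ}
    (hwV : ∀ i, w i ∈ D.Vh) (hw : ∀ i, ∀ x ∈ D.K.vertices, w i x = D.θ i x * e x) :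
    e = ∑ i, w i := by
  rw [← sub_eq_zero]
  refine eq_zero_of_vertices (D.Vh.sub_mem he (D.Vh.sum_mem fun i _ => hwV i)) fun x hx => ?_
  rw [Pi.sub_apply, Finset.sum_apply, Finset.sum_congr rfl fun i _ => hw i x hx, ← Finset.sum_mul]
  by_cases hxΩ : x ∈ D.Ω
  · rw [D.θ_sum x hx hxΩ, one_mul, sub_self]
  · rw [he.2.2 x hxΩ, mul_zero, sub_self]

end Setting

end Schwarz

end

theorem mainTheorem2 (r : ℕ) (hr : 0 < r) (σ κ : ℝ) (hσ : 0 < σ) :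
    ∃ C_I : ℝ, 0 < C_I ∧
      ∀ (D : Schwarz.Setting r) (C : ℕ) (S : D.EigenSystem) (Λ : ℝ),
        D.ShapeRegular σ → D.Resolves κ → D.OverlapAtMost C → 0 < Λ →
        ∀ u ∈ D.Vh,
          ∃ u₀ ∈ Schwarz.Setting.Vglb S Λ,
            (∀ v ∈ Schwarz.Setting.Vglb S Λ, D.a u₀ v = D.a u v) ∧
            ∃ w : Fin D.N → Schwarz.Pt r → ℝ,
              (∀ i, w i ∈ D.V0 i ∧ D.IsNodalInterpolant (D.θ i * (u - u₀)) (w i)) ∧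
              u = u₀ + ∑ i, w i ∧
              (∑ i, D.a (w i) (w i)) + D.a u₀ u₀ ≤
                2 * C * C_I * (1 + Λ⁻¹) * D.a u u := by
  open Schwarz Schwarz.Setting in
  refine ⟨1 + |stabConst r σ κ|, by positivity, ?_⟩
  intro D C S Λ hreg h hC hΛ u hu
  have hρ := h.integrableOn
  obtain ⟨u₀', hu₀, hproj⟩ := exists_projection (D.energy.domRestrict₁₂ D.Vh D.Vh)
    (fun v hv => Subtype.ext (h.eq_zero_of_energy_eq_zero hr v.2 hv))
    ((Vglb S Λ).comap D.Vh.subtype) ⟨u, hu⟩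
  obtain ⟨u₀, hu₀V⟩ := u₀'
  have hproj' : ∀ v ∈ Vglb S Λ, D.energy u₀ v = D.energy u v :=
    fun v hv => hproj ⟨v, Vglb_le_Vh hv⟩ hv
  set e := u - u₀ with he_def
  have he : e ∈ D.Vh := D.Vh.sub_mem hu hu₀V
  have horth : ∀ v ∈ Vglb S Λ, D.energy v e = 0 := by
    intro v hv
    rw [he_def, map_sub, energy_symm v u, energy_symm v u₀, hproj' v hv, sub_self]
  choose w hwV hw using fun i => exists_mem_Vh_eq_on_vertices (D := D) (f := D.θ i * e)
    fun x _ hx => by rw [Pi.mul_apply, he.2.2 x hx, mul_zero]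
  refine ⟨u₀, hu₀, fun v hv => ?_, w, fun i => ⟨mem_V0_of_vertices i (hwV i) (hw i), hwV i, hw i⟩,
    ?_, ?_⟩
  · rw [a_eq_energy hρ hu₀V (Vglb_le_Vh hv), a_eq_energy hρ hu (Vglb_le_Vh hv), hproj' v hv]
  · rw [← eq_sum_pieces he hwV hw, he_def, add_sub_cancel]
  rw [Finset.sum_congr rfl fun i _ => a_eq_energy hρ (hwV i) (hwV i), a_eq_energy hρ hu₀V hu₀V,
    a_eq_energy hρ hu hu]
  have hpyth : D.energy u u = D.energy e e + D.energy u₀ u₀ := by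
    have h0 : D.energy u₀ e = 0 := horth u₀ hu₀
    have hu' : u = u₀ + e := by rw [he_def, add_sub_cancel]
    rw [hu']
    simp only [map_add, LinearMap.add_apply, h0, energy_symm e u₀]
    ring
  have hs : ∑ k, sForm hρ k e e ≤ Λ⁻¹ * D.energy e e := by
    rw [← sum_aForm, Finset.mul_sum]
    refine Finset.sum_le_sum fun k _ => ?_
    rw [le_inv_mul_iff₀ hΛ]
    exact h.mul_sForm_le_aForm k he (h.sForm_eq_zero_of_orthogonal hr he horth k)
  have hs0 : 0 ≤ ∑ k, sForm hρ k e e := Finset.sum_nonneg fun k _ => h.sForm_nonneg k e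
  have hE := h.energy_nonneg e
  have hE₀ := h.energy_nonneg u₀
  have hC1 : (1 : ℝ) ≤ C := by exact_mod_cast hC.one_le
  have hL : 0 < Λ⁻¹ := inv_pos.2 hΛ
  set B := |stabConst r σ κ|
  have hB : 0 ≤ B := abs_nonneg _
  have hpieces : ∑ i, D.energy (w i) (w i) ≤ 2 * C * D.energy e e + B * (Λ⁻¹ * D.energy e e) := by
    refine (sum_energy_pieces_le hr hσ hreg h hC hw).trans (add_le_add le_rfl ?_)
    calc stabConst r σ κ * ∑ k, sForm hρ k e e ≤ B * ∑ k, sForm hρ k e e := by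
          gcongr
          exact le_abs_self _
      _ ≤ _ := by gcongr
  have h1 : 2 * C + B * Λ⁻¹ ≤ 2 * C * (1 + B) * (1 + Λ⁻¹) := by
    have : B * Λ⁻¹ ≤ C * (B * Λ⁻¹) := le_mul_of_one_le_left (by positivity) hC1
    have h2 : 0 ≤ C * B := by positivity
    have h3 : 0 ≤ C * Λ⁻¹ := by positivity
    have h4 : 0 ≤ C * (B * Λ⁻¹) := by positivity
    linarith
  have h2 : 1 ≤ 2 * C * (1 + B) * (1 + Λ⁻¹) := by
    have : 0 ≤ B * Λ⁻¹ := by positivity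
    linarith
  rw [hpyth]
  calc ∑ i, D.energy (w i) (w i) + D.energy u₀ u₀
      ≤ (2 * C + B * Λ⁻¹) * D.energy e e + 1 * D.energy u₀ u₀ := by linarith
    _ ≤ 2 * C * (1 + B) * (1 + Λ⁻¹) * D.energy e e
        + 2 * C * (1 + B) * (1 + Λ⁻¹) * D.energy u₀ u₀ := by gcongr
    _ = _ := by ring
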